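/- Let $G=(V,E)$ be a median graph, that is, a finite connected simple graph in which, for all vertices $x,y,z$, the set $I(x,y)\cap I(y,z)\cap I(z,x)$ consists of exactly one vertex, where $I(u,v)=\{x\in V : d(u,x)+d(x,v)=d(u,v)\}$ and $d$ is the graph distance. Two edges $uv$ and $u'v'$ of $G$ are opposite if $u\,v\,v'\,u'$ is a $4$-cycle of $G$; let $\Theta$ be the reflexive and transitive closure of this relation on $E$. Its equivalence classes are called the $\Theta$-classes of $G$. Theorem. The $\Theta$-classes of a median graph $G$ with $m$ edges can be computed in $O(m)$ time. Precisely: there are a single random access machine program $P$ and constants $C,c\in\mathbb{N}$ such that the following holds for every median graph $G$ with vertex set $\{0,\dots,n-1\}$ and every list $e_0,\dots,e_{m-1}$ containing each edge of $G$ exactly once (in any order, as a pair of endpoints in any order). Given $n$, $m$ and this list as input, on a machine with words of $w$ bits, where $w$ is any integer with $2^w\ge (n+m+1)^c$, and with arbitrary initial contents of the memory not used by the input, $P$ terminates without overflow after at most $C(m+1)$ elementary steps. Its output consists of the number $q$ of $\Theta$-classes of $G$ and numbers $\ell_0,\dots,\ell_{m-1}$ with $\{\ell_0,\dots,\ell_{m-1}\}=\{0,\dots,q-1\}$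 such that, for all $i,j$, $\ell_i=\ell_j$ if and only if $e_i$ and $e_j$ belong to the same $\Theta$-class. The elementary steps, each of cost $1$, are: loading a constant, copying, adding or (truncated) subtracting registers, reading or writing one array cell at an address held in a register, and comparing two registers (by $<$ or $=$) to control branches and while loops. -/

import Mathlib

/-! ### Median graphs and their parallelism classes of edges -/

namespace SimpleGraph

variable {V : Type*}

/-- The interval `I(u,v)`: all vertices on shortest paths between `u` and `v`
(used in connected graphs only). -/
def interval (G : SimpleGraph V) (u v : V) : Set V :=
  {x | G.dist u x + G.dist x v = G.dist u v}

/-- A median graph: a connected graph in which, for any three vertices, the three intervals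
between them have exactly one common vertex. -/
def IsMedian (G : SimpleGraph V) : Prop :=
  G.Connected ∧
    ∀ x y z : V, ∃! v : V, v ∈ G.interval x y ∩ G.interval y z ∩ G.interval z x

/-- `e` and `e'` are opposite edges of a square (4-cycle) `u v v' u'` of `G`. -/
def OppositeEdges (G : SimpleGraph V) (e e' : Sym2 V) : Prop :=
  ∃ u v u' v' : V, e = s(u, v) ∧ e' = s(u', v') ∧
    G.Adj u v ∧ G.Adj v v' ∧ G.Adj v' u' ∧ G.Adj u' u ∧ u ≠ v' ∧ v ≠ u'

/-- The relation `Θ` on edges: the reflexive and transitive closure of being opposite edges of a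
square. -/
def Theta (G : SimpleGraph V) : Sym2 V → Sym2 V → Prop :=
  Relation.ReflTransGen G.OppositeEdges

/-- `L` lists every edge of `G` exactly once, in some order, each as a pair of endpoints given in
one of the two possible orders. -/
def IsEdgeList (G : SimpleGraph V) (L : List (V × V)) : Prop :=
  (L.map (fun p => s(p.1, p.2))).Nodup ∧
    ∀ e : Sym2 V, e ∈ L.map (fun p => s(p.1, p.2)) ↔ e ∈ G.edgeSet

end SimpleGraph

/-! ### The word RAM

A random access machine with words of `w` bits. A program works on integer registers and on
integer arrays; being a finite text, it refers to finitely many of them. An elementary operation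
(constant, copy, addition, truncated subtraction, reading or writing one array cell at an address
held in a register, comparison of two registers) takes one time unit. There is no multiplication,
and an operation whose result does not fit into `w` bits cannot be executed. -/

namespace WordRAM

/-- The contents of the registers and of the cells of the arrays. -/
structure State where
  reg : ℕ → ℕ
  arr : ℕ → ℕ → ℕ

/-- Every register and every array cell holds a `w`-bit word. -/
def State.Fits (w : ℕ) (s : State) : Prop :=
  (∀ r, s.reg r < 2 ^ w) ∧ ∀ k i, s.arr k i < 2 ^ w

/-- Write `v` to register `r`; undefined if `v` is not a `w`-bit word. -/
def State.setReg (w : ℕ) (s : State) (r v : ℕ) : Option State :=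
  if v < 2 ^ w then some { s with reg := Function.update s.reg r v } else none

/-- Write `v` to cell `i` of array `k`; undefined if `v` is not a `w`-bit word. -/
def State.setArr (w : ℕ) (s : State) (k i v : ℕ) : Option State :=
  if v < 2 ^ w then
    some { s with arr := Function.update s.arr k (Function.update (s.arr k) i v) }
  else none

/-- Elementary instructions. The arguments `r a b` name registers, `k` names an array, and `c` is
an integer constant. -/
inductive Instr where
  /-- `R_r := c` -/
  | const (r c : ℕ)
  /-- `R_r := R_a` -/
  | copy (r a : ℕ)
  /-- `R_r := R_a + R_b` -/
  | add (r a b : ℕ)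
  /-- `R_r := max (R_a - R_b) 0` -/
  | sub (r a b : ℕ)
  /-- `R_r := A_k[R_a]` -/
  | load (r k a : ℕ)
  /-- `A_k[R_a] := R_b` -/
  | store (k a b : ℕ)

/-- The effect of an elementary instruction on a machine with `w`-bit words. -/
def Instr.eval (w : ℕ) : Instr → State → Option State
  | .const r c, s => s.setReg w r c
  | .copy r a, s => s.setReg w r (s.reg a)
  | .add r a b, s => s.setReg w r (s.reg a + s.reg b)
  | .sub r a b, s => s.setReg w r (s.reg a - s.reg b)
  | .load r k a, s => s.setReg w r (s.arr k (s.reg a))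
  | .store k a b, s => s.setArr w k (s.reg a) (s.reg b)

/-- Tests on two registers. -/
inductive Test where
  /-- `R_a < R_b` -/
  | lt (a b : ℕ)
  /-- `R_a = R_b` -/
  | eq (a b : ℕ)

/-- The test succeeds in the given state. -/
def Test.Holds : Test → State → Prop
  | .lt a b, s => s.reg a < s.reg b
  | .eq a b, s => s.reg a = s.reg b

/-- Programs: elementary instructions, sequential composition, branching, and while loops. -/
inductive Program where
  | skip
  | instr (i : Instr)
  | seq (p q : Program)
  | ite (b : Test) (p q : Program)
  | loop (b : Test) (p : Program)

/-- `Runs w p s s' t`: on a machine with `w`-bit words, the program `p` started in state `s`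
terminates in state `s'` after exactly `t` time units, and no overflow occurs. Every instruction
and every evaluation of a test takes one time unit. -/
inductive Runs (w : ℕ) : Program → State → State → ℕ → Prop where
  | skip (s : State) : Runs w .skip s s 1
  | instr {i : Instr} {s s' : State} (h : i.eval w s = some s') : Runs w (.instr i) s s' 1
  | seq {p q : Program} {s s₁ s₂ : State} {t₁ t₂ : ℕ}
      (hp : Runs w p s s₁ t₁) (hq : Runs w q s₁ s₂ t₂) : Runs w (.seq p q) s s₂ (t₁ + t₂)
  | ite_true {b : Test} {p q : Program} {s s' : State} {t : ℕ}
      (hb : b.Holds s) (h : Runs w p s s' t) : Runs w (.ite b p q) s s' (1 + t)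
  | ite_false {b : Test} {p q : Program} {s s' : State} {t : ℕ}
      (hb : ¬ b.Holds s) (h : Runs w q s s' t) : Runs w (.ite b p q) s s' (1 + t)
  | loop_exit {b : Test} {p : Program} {s : State}
      (hb : ¬ b.Holds s) : Runs w (.loop b p) s s 1
  | loop_step {b : Test} {p : Program} {s s₁ s₂ : State} {t₁ t₂ : ℕ}
      (hb : b.Holds s) (hp : Runs w p s s₁ t₁) (hl : Runs w (.loop b p) s₁ s₂ t₂) :
      Runs w (.loop b p) s s₂ (1 + t₁ + t₂)

/-- The state `s` holds the graph with vertices `0, …, n-1` and edge list `L` as input: register 0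
holds the number of vertices, register 1 the number of edges, and the cells `i` of arrays 0 and 1
the two endpoints of the `i`-th edge. All other registers and cells are arbitrary
(uninitialized). -/
def IsInput {n : ℕ} (L : List (Fin n × Fin n)) (s : State) : Prop :=
  s.reg 0 = n ∧ s.reg 1 = L.length ∧
    ∀ i : Fin L.length, s.arr 0 i = (L.get i).1 ∧ s.arr 1 i = (L.get i).2

/-- The state `s` holds the `Θ`-classes of the graph `G` with edge list `L` as output: register 2
holds their number `q`, and array 2 holds in cell `i` the number in `{0, …, q-1}` of the
`Θ`-class of the `i`-th edge, where different classes have different numbers and every number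
is used. -/
def IsThetaOutput {n : ℕ} (G : SimpleGraph (Fin n)) (L : List (Fin n × Fin n)) (s : State) :
    Prop :=
  (∀ i : Fin L.length, s.arr 2 i < s.reg 2) ∧
  (∀ k < s.reg 2, ∃ i : Fin L.length, s.arr 2 i = k) ∧
  ∀ i j : Fin L.length, s.arr 2 i = s.arr 2 j ↔
    G.Theta s((L.get i).1, (L.get i).2) s((L.get j).1, (L.get j).2)

end WordRAM

/-! ### Downward edges and roots of parallelism classes in a median graph -/

namespace SimpleGraph

variable {V : Type*} {G : SimpleGraph V}

lemma Connected.dist_adj_le (hG : G.Connected) (b : V) {x y : V} (h : G.Adj x y) :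
    G.dist b x ≤ G.dist b y + 1 := by
  have h1 := hG.dist_triangle (u := b) (v := y) (w := x)
  rwa [dist_eq_one_iff_adj.2 h.symm] at h1

namespace IsMedian

lemma dist_ne (hG : G.IsMedian) (b : V) {x y : V} (h : G.Adj x y) :
    G.dist b x ≠ G.dist b y := by
  obtain ⟨m, ⟨⟨h1, h2⟩, h3⟩, -⟩ := hG.2 b x y
  simp only [interval, Set.mem_ofPred_eq] at h1 h2 h3
  have hxy := dist_eq_one_iff_adj.2 h
  have hyx := dist_eq_one_iff_adj.2 h.symm
  rw [hxy] at h2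
  rcases Nat.eq_zero_or_pos (G.dist x m) with h0 | h0
  · obtain rfl := hG.1.dist_eq_zero_iff.1 h0
    rw [hyx, dist_comm (v := b), dist_comm (v := b)] at h3
    omega
  · have h0 : G.dist m y = 0 := by omega
    obtain rfl := hG.1.dist_eq_zero_iff.1 h0
    rw [hyx] at h1
    omega

lemma dist_adj (hG : G.IsMedian) (b : V) {x y : V} (h : G.Adj x y) :
    G.dist b x = G.dist b y + 1 ∨ G.dist b y = G.dist b x + 1 := by
  have h1 := hG.1.dist_adj_le b h
  have h2 := hG.1.dist_adj_le b h.symm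
  have h3 := hG.dist_ne b h
  omega

lemma dist_eq_two (hG : G.IsMedian) {u v x : V} (huv : u ≠ v) (hu : G.Adj u x) (hv : G.Adj v x) :
    G.dist u v = 2 := by
  have h1 := hG.1.dist_adj_le u hv
  rw [dist_eq_one_iff_adj.2 hu] at h1
  have h2 : G.dist u v ≠ 0 := fun h => huv (hG.1.dist_eq_zero_iff.1 h)
  have h3 : G.dist u v ≠ 1 := fun h => by
    have h4 := hG.dist_ne x (dist_eq_one_iff_adj.1 h)
    rw [dist_eq_one_iff_adj.2 hu.symm, dist_eq_one_iff_adj.2 hv.symm] at h4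
    exact h4 rfl
  omega

/-- A median graph does not contain the complete bipartite graph `K_{2,3}`. -/
lemma not_three_common (hG : G.IsMedian) {u v x y z : V} (huv : u ≠ v)
    (hxy : x ≠ y) (hyz : y ≠ z) (hxz : x ≠ z) (hux : G.Adj u x) (huy : G.Adj u y)
    (huz : G.Adj u z) (hvx : G.Adj v x) (hvy : G.Adj v y) (hvz : G.Adj v z) : False := by
  have key : ∀ c, G.Adj c x → G.Adj c y → G.Adj c z →
      c ∈ G.interval x y ∩ G.interval y z ∩ G.interval z x := by
    intro c hx hy hz
    refine ⟨⟨?_, ?_⟩, ?_⟩ <;> simp only [interval, Set.mem_ofPred_eq]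
    · rw [hG.dist_eq_two hxy hx.symm hy.symm, dist_eq_one_iff_adj.2 hx.symm,
        dist_eq_one_iff_adj.2 hy]
    · rw [hG.dist_eq_two hyz hy.symm hz.symm, dist_eq_one_iff_adj.2 hy.symm,
        dist_eq_one_iff_adj.2 hz]
    · rw [hG.dist_eq_two hxz.symm hz.symm hx.symm, dist_eq_one_iff_adj.2 hz.symm,
        dist_eq_one_iff_adj.2 hx]
  exact huv ((hG.2 x y z).unique (key u hux huy huz) (key v hvx hvy hvz))

end IsMedian

/-- `d` is a neighbour of `x` that is closer to the base vertex `b`. -/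
def Desc (G : SimpleGraph V) (b x d : V) : Prop :=
  G.Adj x d ∧ G.dist b d + 1 = G.dist b x

/-- The vertices that are closer to `x` than to `d`. -/
def farSide (G : SimpleGraph V) (x d : V) : Set V :=
  {y | G.dist y x < G.dist y d}

/-- `s` is the only neighbour of `r` that is closer to `b`. -/
def IsRoot (G : SimpleGraph V) (b r s : V) : Prop :=
  G.Desc b r s ∧ ∀ d, G.Desc b r d → d = s

lemma Connected.exists_desc (hG : G.Connected) {b x : V} (h : x ≠ b) : ∃ d, G.Desc b x d := by
  obtain ⟨p, hp⟩ := hG.exists_walk_length_eq_dist x b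
  cases p with
  | nil => exact absurd rfl h
  | cons hadj q =>
    rename_i d
    refine ⟨d, hadj, ?_⟩
    have h1 := dist_le q
    have h2 := hG.dist_adj_le b hadj
    rw [Walk.length_cons, dist_comm] at hp
    rw [dist_comm] at h1
    omega

namespace IsMedian

variable {b : V}

lemma desc_or_desc (hG : G.IsMedian) {x y : V} (h : G.Adj x y) :
    G.Desc b x y ∨ G.Desc b y x := by
  rcases hG.dist_adj b h with h1 | h1
  · exact Or.inl ⟨h, h1.symm⟩
  · exact Or.inr ⟨h.symm, h1.symm⟩

lemma desc_iff (hG : G.IsMedian) {x y : V} (h : G.Adj x y) :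
    G.Desc b x y ↔ b ∉ G.farSide x y := by
  simp only [Desc, h, true_and, farSide, Set.mem_ofPred_eq]
  rcases hG.dist_adj b h with h1 | h1 <;> omega

lemma quadrangle (hG : G.IsMedian) {x u v : V} (huv : u ≠ v) (hu : G.Desc b x u)
    (hv : G.Desc b x v) : ∃ z, G.Desc b u z ∧ G.Desc b v z := by
  obtain ⟨m, ⟨⟨h1, h2⟩, h3⟩, -⟩ := hG.2 b u v
  simp only [interval, Set.mem_ofPred_eq] at h1 h2 h3
  rw [hG.dist_eq_two huv hu.1.symm hv.1.symm] at h2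
  rw [dist_comm (u := m) (v := b), dist_comm (u := v) (v := b), dist_comm (u := v) (v := m)] at h3
  rw [dist_comm (u := m) (v := u)] at h1
  have hu2 := hu.2
  have hv2 := hv.2
  refine ⟨m, ⟨dist_eq_one_iff_adj.1 (by omega), by omega⟩,
    ⟨dist_eq_one_iff_adj.1 ?_, by omega⟩⟩
  rw [dist_comm]
  omega

lemma farSide_subset (hG : G.IsMedian) {u v u' v' : V} (h1 : G.Adj u v) (h2 : G.Adj v v')
    (h3 : G.Adj v' u') (h4 : G.Adj u' u) (h5 : u ≠ v') (h6 : v ≠ u') :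
    G.farSide u v ⊆ G.farSide u' v' := by
  intro x hx
  simp only [farSide, Set.mem_ofPred_eq] at hx ⊢
  by_contra hcon
  have e1 := hG.dist_adj x h1
  have e2 := hG.dist_adj x h2
  have e3 := hG.dist_adj x h3
  have e4 := hG.dist_adj x h4
  obtain ⟨m, hm1, hm2⟩ := hG.quadrangle (b := x) (x := v) h5 ⟨h1.symm, by omega⟩ ⟨h2, by omega⟩
  have hm3 := hm1.2
  have hm4 := hm2.2
  refine hG.not_three_common h5 h6 (?_ : u' ≠ m) (?_ : v ≠ m) h1 h4.symm hm1.1 h2.symm h3 hm2.1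
  · rintro rfl; omega
  · rintro rfl; omega

/-- Opposite edges of a square determine the same halfspaces. -/
lemma farSide_eq (hG : G.IsMedian) {u v u' v' : V} (h1 : G.Adj u v) (h2 : G.Adj v v')
    (h3 : G.Adj v' u') (h4 : G.Adj u' u) (h5 : u ≠ v') (h6 : v ≠ u') :
    G.farSide u v = G.farSide u' v' :=
  (hG.farSide_subset h1 h2 h3 h4 h5 h6).antisymm
    (hG.farSide_subset h3.symm h2.symm h1.symm h4.symm h6.symm h5.symm)

lemma dist_root (hG : G.IsMedian) {r s y : V} (hr : G.IsRoot b r s) (hy : y ∈ G.farSide r s) :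
    G.dist b y = G.dist b r + G.dist r y := by
  obtain ⟨m, ⟨⟨h1, h2⟩, h3⟩, -⟩ := hG.2 b y r
  simp only [interval, Set.mem_ofPred_eq] at h1 h2 h3
  by_cases hm : r = m
  · subst hm
    rw [← h1]
  · exfalso
    obtain ⟨d, hd⟩ := hG.1.exists_desc (b := m) hm
    have e1 := hd.2
    have hdr : G.Desc b r d := by
      refine ⟨hd.1, ?_⟩
      have t1 := hG.1.dist_triangle (u := b) (v := m) (w := d)
      have t2 := hG.1.dist_adj_le b hd.1
      rw [dist_comm (u := r) (v := m), dist_comm (u := m) (v := b),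
        dist_comm (u := r) (v := b)] at h3
      omega
    obtain rfl := hr.2 d hdr
    simp only [farSide, Set.mem_ofPred_eq] at hy
    have t1 := hG.1.dist_triangle (u := y) (v := m) (w := d)
    omega

lemma root_unique (hG : G.IsMedian) {r s r' s' : V} (hr : G.IsRoot b r s)
    (hr' : G.IsRoot b r' s') (h : G.farSide r s = G.farSide r' s') : r = r' := by
  have m1 : r ∈ G.farSide r s := by
    simp [farSide, dist_eq_one_iff_adj.2 hr.1.1]
  have m2 : r' ∈ G.farSide r' s' := by
    simp [farSide, dist_eq_one_iff_adj.2 hr'.1.1]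
  have e1 := hG.dist_root hr (h ▸ m2)
  have e2 := hG.dist_root hr' (h ▸ m1)
  exact hG.1.dist_eq_zero_iff.1 (by omega)

lemma opposite_of_square {x u v z : V} (huv : u ≠ v) (hu : G.Desc b x u)
    (hv : G.Desc b x v) (huz : G.Desc b u z) (hvz : G.Desc b v z) :
    G.OppositeEdges s(x, u) s(v, z) := by
  refine ⟨x, u, v, z, rfl, rfl, hu.1, huz.1, hvz.1.symm, hv.1.symm, ?_, huv⟩
  rintro rfl
  have := hu.2
  have := huz.2
  omega

lemma farSide_of_square (hG : G.IsMedian) {x u v z : V} (huv : u ≠ v) (hu : G.Desc b x u)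
    (hv : G.Desc b x v) (huz : G.Desc b u z) (hvz : G.Desc b v z) :
    G.farSide x u = G.farSide v z := by
  refine hG.farSide_eq hu.1 huz.1 hvz.1.symm hv.1.symm ?_ huv
  rintro rfl
  have := hu.2
  have := huz.2
  omega

lemma exists_root (hG : G.IsMedian) {x u : V} (h : G.Desc b x u) :
    ∃ r s, G.IsRoot b r s ∧ G.Theta s(x, u) s(r, s) ∧ G.farSide x u = G.farSide r s ∧
      (r = x ∨ G.dist b r < G.dist b x) := by
  induction hk : G.dist b x using Nat.strong_induction_on generalizing x u with
  | _ k ih =>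
    by_cases hroot : ∀ d, G.Desc b x d → d = u
    · exact ⟨x, u, ⟨h, hroot⟩, .refl, rfl, Or.inl rfl⟩
    · push Not at hroot
      obtain ⟨v, hv, hvu⟩ := hroot
      obtain ⟨z, hz1, hz2⟩ := hG.quadrangle hvu.symm h hv
      have hlt := hv.2
      obtain ⟨r, s, h1, h2, h3, h4⟩ := ih (G.dist b v) (by omega) hz2 rfl
      refine ⟨r, s, h1, ?_, ?_, Or.inr ?_⟩
      · exact .head (opposite_of_square hvu.symm h hv hz1 hz2) h2
      · rw [hG.farSide_of_square hvu.symm h hv hz1 hz2, h3]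
      · rcases h4 with rfl | h4 <;> omega

end IsMedian

open Classical in
/-- The vertex closest to `b` on the far side of the downward edge from `x` to `d`. -/
noncomputable def rootOf (G : SimpleGraph V) (b x d : V) : V :=
  if h : ∃ r s, G.IsRoot b r s ∧ G.farSide x d = G.farSide r s then h.choose else x

namespace IsMedian

variable {b : V}

lemma rootOf_spec (hG : G.IsMedian) {x u : V} (h : G.Desc b x u) :
    ∃ s, G.IsRoot b (G.rootOf b x u) s ∧ G.Theta s(x, u) s(G.rootOf b x u, s) ∧
      G.farSide x u = G.farSide (G.rootOf b x u) s ∧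
      (G.rootOf b x u = x ∨ G.dist b (G.rootOf b x u) < G.dist b x) := by
  obtain ⟨r, s, h1, h2, h3, h4⟩ := hG.exists_root h
  have hex : ∃ r s, G.IsRoot b r s ∧ G.farSide x u = G.farSide r s := ⟨r, s, h1, h3⟩
  have heq : G.rootOf b x u = r := by
    rw [rootOf, dif_pos hex]
    obtain ⟨s', h1', h3'⟩ := hex.choose_spec
    exact hG.root_unique h1' h1 (h3'.symm.trans h3)
  rw [heq]
  exact ⟨s, h1, h2, h3, h4⟩

lemma rootOf_eq_iff (hG : G.IsMedian) {x u y v : V} (h : G.Desc b x u) (h' : G.Desc b y v) :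
    G.rootOf b x u = G.rootOf b y v ↔ G.farSide x u = G.farSide y v := by
  obtain ⟨s, h1, -, h3, -⟩ := hG.rootOf_spec h
  obtain ⟨s', h1', -, h3', -⟩ := hG.rootOf_spec h'
  constructor
  · intro he
    rw [he] at h1 h3
    rw [h3, h3', h1'.2 s h1.1]
  · intro he
    exact hG.root_unique h1 h1' (by rw [← h3, ← h3', he])

lemma rootOf_root (hG : G.IsMedian) {r s : V} (h : G.IsRoot b r s) : G.rootOf b r s = r := by
  obtain ⟨s', h1, -, h3, -⟩ := hG.rootOf_spec h.1
  exact hG.root_unique h1 h h3.symm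

lemma rootOf_square (hG : G.IsMedian) {x u v z : V} (huv : u ≠ v) (hu : G.Desc b x u)
    (hv : G.Desc b x v) (huz : G.Desc b u z) (hvz : G.Desc b v z) :
    G.rootOf b x u = G.rootOf b v z :=
  (hG.rootOf_eq_iff hu hvz).2 (hG.farSide_of_square huv hu hv huz hvz)

lemma rootOf_injective (hG : G.IsMedian) {x u v : V} (hu : G.Desc b x u) (hv : G.Desc b x v)
    (h : G.rootOf b x u = G.rootOf b x v) : u = v := by
  by_contra huv
  have h1 := (hG.rootOf_eq_iff hu hv).1 h
  have h2 : u ∈ G.farSide x v := by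
    simp only [farSide, Set.mem_ofPred_eq]
    rw [hG.dist_eq_two huv hu.1.symm hv.1.symm, dist_eq_one_iff_adj.2 hu.1.symm]
    norm_num
  rw [← h1] at h2
  simp [farSide] at h2

lemma exists_desc_of_theta (hG : G.IsMedian) {x u : V} (h : G.Desc b x u) {e : Sym2 V}
    (he : G.Theta s(x, u) e) :
    ∃ y v, e = s(y, v) ∧ G.Desc b y v ∧ G.farSide x u = G.farSide y v := by
  induction he with
  | refl => exact ⟨x, u, rfl, h, rfl⟩
  | tail _ hopp ih =>
    obtain ⟨y, v, rfl, hd, hf⟩ := ih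
    obtain ⟨a, c, a', c', h1, rfl, h2, h3, h4, h5, h6, h7⟩ := hopp
    rcases Sym2.eq_iff.1 h1 with ⟨rfl, rfl⟩ | ⟨rfl, rfl⟩
    · have hfs := hG.farSide_eq h2 h3 h4 h5 h6 h7
      refine ⟨a', c', rfl, (hG.desc_iff h4.symm).2 ?_, hf.trans hfs⟩
      rw [← hfs]
      exact (hG.desc_iff hd.1).1 hd
    · have hfs := hG.farSide_eq h2.symm h5.symm h4.symm h3.symm h7 h6
      refine ⟨c', a', Sym2.eq_swap, (hG.desc_iff h4).2 ?_, hf.trans hfs⟩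
      rw [← hfs]
      exact (hG.desc_iff hd.1).1 hd

lemma theta_symm {e e' : Sym2 V} (h : G.Theta e e') : G.Theta e' e := by
  have hs : Std.Symm G.OppositeEdges := by
    refine ⟨?_⟩
    rintro e e' ⟨u, v, u', v', rfl, rfl, h1, h2, h3, h4, h5, h6⟩
    exact ⟨u', v', u, v, rfl, rfl, h3.symm, h2.symm, h1.symm, h4.symm, h6.symm, h5.symm⟩
  exact (Relation.ReflTransGen.stdSymm (r := G.OppositeEdges)).symm _ _ h

/-- Two downward edges are parallel if and only if their classes have the same root. -/
lemma theta_iff (hG : G.IsMedian) {x u y v : V} (h : G.Desc b x u) (h' : G.Desc b y v) :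
    G.Theta s(x, u) s(y, v) ↔ G.rootOf b x u = G.rootOf b y v := by
  constructor
  · intro ht
    obtain ⟨y', v', he, hd, hf⟩ := hG.exists_desc_of_theta h ht
    rcases Sym2.eq_iff.1 he with ⟨rfl, rfl⟩ | ⟨rfl, rfl⟩
    · exact (hG.rootOf_eq_iff h h').2 hf
    · have := hd.2
      have := h'.2
      omega
  · intro he
    obtain ⟨s, h1, h2, -, -⟩ := hG.rootOf_spec h
    obtain ⟨s', h1', h2', -, -⟩ := hG.rootOf_spec h'
    rw [he] at h1 h2
    rw [h1'.2 s h1.1] at h2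
    exact h2.trans (theta_symm h2')

/-- If the downward path `x, u, w` is not contained in a square, then the class of `uw` has a root
that is closer to the base vertex than the root of the class of `xu`. -/
lemma dist_rootOf_lt (hG : G.IsMedian) {x u w : V} (hu : G.Desc b x u) (hw : G.Desc b u w)
    (ht : ∀ m, G.Adj x m → G.Adj m w → m = u) :
    G.dist b (G.rootOf b u w) < G.dist b (G.rootOf b x u) := by
  induction hk : G.dist b x using Nat.strong_induction_on generalizing x u w with
  | _ k ih =>
    have hu2 := hu.2
    have hw2 := hw.2
    by_cases hroot : ∀ d, G.Desc b x d → d = u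
    · rw [hG.rootOf_root ⟨hu, hroot⟩]
      obtain ⟨s, -, -, -, h4⟩ := hG.rootOf_spec hw
      rcases h4 with h4 | h4
      · rw [h4]; omega
      · omega
    · push Not at hroot
      obtain ⟨v, hv, hvu⟩ := hroot
      obtain ⟨z, hz1, hz2⟩ := hG.quadrangle hvu.symm hu hv
      have hzw : z ≠ w := by
        rintro rfl
        exact hvu (ht v hv.1 hz2.1)
      obtain ⟨t, ht1, ht2⟩ := hG.quadrangle hzw hz1 hw
      rw [hG.rootOf_square hvu.symm hu hv hz1 hz2, hG.rootOf_square hzw.symm hw hz1 ht2 ht1]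
      have hv2 := hv.2
      have hz22 := hz2.2
      have ht12 := ht1.2
      refine ih (G.dist b v) (by omega) hz2 ht1 (fun q hq1 hq2 => ?_) rfl
      by_contra hqz
      have hqd : G.Desc b v q := by
        refine ⟨hq1, ?_⟩
        have e1 := hG.dist_adj b hq1
        have e2 := hG.dist_adj b hq2
        omega
      have hqd2 := hqd.2
      have hxw : x ≠ w := by rintro rfl; omega
      have hqw : q ≠ w := by
        rintro rfl
        exact hvu (ht v hv.1 hq1)
      have hxq : x ≠ q := by rintro rfl; omega
      obtain ⟨m, ⟨⟨m1, m2⟩, m3⟩, -⟩ := hG.2 x w q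
      simp only [interval, Set.mem_ofPred_eq] at m1 m2 m3
      rw [hG.dist_eq_two hxw hu.1 hw.1.symm] at m1
      rw [hG.dist_eq_two hqw.symm ht2.1 hq2] at m2
      rw [hG.dist_eq_two hxq.symm hq1.symm hv.1, dist_comm (u := q) (v := m),
        dist_comm (u := m) (v := x)] at m3
      rw [dist_comm (u := w)] at m2
      have a1 : G.Adj x m := dist_eq_one_iff_adj.1 (by omega)
      have a2 : G.Adj m w := dist_eq_one_iff_adj.1 (by omega)
      have a3 : G.Adj m q := dist_eq_one_iff_adj.1 (by omega)
      obtain rfl := ht m a1 a2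
      refine hG.not_three_common hvu (?_ : x ≠ z) (Ne.symm hqz) hxq hv.1.symm hz2.1 hq1
        hu.1.symm hz1.1 a3
      rintro rfl
      omega

end IsMedian

end SimpleGraph

/-! ### Breadth-first search that numbers the parallelism classes -/

namespace SimpleGraph

variable {n : ℕ}

lemma update_val_ne (f : ℕ → ℕ) (a : ℕ) {x u : Fin n} (h : x ≠ u) :
    Function.update f (u : ℕ) a (x : ℕ) = f x :=
  Function.update_of_ne (fun h' => h (Fin.ext h')) _ _

/-- The invariant of the search from `b`. The vertices in `done` have been removed from the
queue, those in `queue` have been found, and `S d x` says that the edge from `d` to `x` has been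
scanned from `d`. For a vertex `x` in the queue, `lo x` and `hi x` are the least and the greatest
value of `hi` at the neighbours from which `x` has been scanned, and `par x` attains the least
one. For a vertex `x` in `done`, `hi x` is the greatest number of a class of a downward edge from
`x`, and `par x` is the end of this edge. The number of a class is the value of `hi` at its root. -/
structure SearchInv (G : SimpleGraph (Fin n)) (b : Fin n) (ix : Fin n → Fin n → ℕ)
    (done queue : List (Fin n)) (S : Fin n → Fin n → Prop) (flag par lo hi lab : ℕ → ℕ)
    (num : ℕ) : Prop where
  nodup : (done ++ queue).Nodup
  sorted : (done ++ queue).Pairwise (fun x y => G.dist b x ≤ G.dist b y)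
  base_mem : b ∈ done ++ queue
  flag_done : ∀ x ∈ done, flag x = 2
  flag_queue : ∀ x ∈ queue, flag x = 1
  flag_new : ∀ x : Fin n, x ∉ done → x ∉ queue → flag x = 0
  scan_done : ∀ d x, S d x → d ∈ done ∧ G.Adj d x
  scan_found : ∀ d x, S d x → x ∈ done ++ queue
  par_base : par b = b
  base_ne : b ∈ queue → lo b ≠ hi b
  acc : ∀ x ∈ queue, x ≠ b → ∃ p : Fin n, par x = p ∧ S p x ∧ lo x = hi p ∧
    (∀ d, S d x → lo x ≤ hi d ∧ hi d ≤ hi x) ∧ ∃ d, S d x ∧ hi d = hi x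
  rootOf_done : ∀ x ∈ done, ∀ d, G.Desc b x d → G.rootOf b x d ∈ done
  fin : ∀ x ∈ done, x ≠ b → ∃ p : Fin n, par x = p ∧ G.Desc b x p ∧
    hi x = hi (G.rootOf b x p) ∧
    ∀ d, G.Desc b x d → d ≠ p → hi (G.rootOf b x d) < hi (G.rootOf b x p)
  root_lt : ∀ r ∈ done, ∀ s, G.IsRoot b r s → hi r < num
  root_mono : ∀ r ∈ done, ∀ r' ∈ done, ∀ s s', G.IsRoot b r s → G.IsRoot b r' s' →
    G.dist b r < G.dist b r' → hi r < hi r'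
  root_inj : ∀ r ∈ done, ∀ r' ∈ done, ∀ s s', G.IsRoot b r s → G.IsRoot b r' s' →
    hi r = hi r' → r = r'
  root_surj : ∀ k < num, ∃ r ∈ done, ∃ s, G.IsRoot b r s ∧ hi r = k
  num_le : num ≤ done.length
  lab_eq : ∀ x u, S x u → G.Desc b x u → lab (ix x u) = hi (G.rootOf b x u)

namespace SearchInv

variable {G : SimpleGraph (Fin n)} {b : Fin n} {ix : Fin n → Fin n → ℕ}
  {done queue : List (Fin n)} {S : Fin n → Fin n → Prop} {flag par lo hi lab : ℕ → ℕ} {num : ℕ}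

lemma length_le (I : SearchInv G b ix done queue S flag par lo hi lab num) :
    done.length + queue.length ≤ n := by
  have := I.nodup.length_le_card
  simpa using this

lemma init (hflag : ∀ x : Fin n, x ≠ b → flag x = 0) (hflag_b : flag b = 1) (hpar : par b = b)
    (hb : lo b ≠ hi b) :
    SearchInv G b ix [] [b] (fun _ _ => False) flag par lo hi lab 0 where
  nodup := by simp
  sorted := by simp
  base_mem := by simp
  flag_done := by simp
  flag_queue := by simpa using hflag_b
  flag_new := by simpa using hflag
  scan_done := by simp
  scan_found := by simp
  par_base := hpar
  base_ne _ := hb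
  acc := by simp +contextual
  rootOf_done := by simp
  fin := by simp
  root_lt := by simp
  root_mono := by simp
  root_inj := by simp
  root_surj := by simp
  num_le := by simp
  lab_eq := by simp

lemma found_of_le (hG : G.IsMedian) {v : Fin n} {rest : List (Fin n)}
    (I : SearchInv G b ix done (v :: rest) S flag par lo hi lab num)
    (hS : ∀ d x, S d x ↔ d ∈ done ∧ G.Adj d x) (x : Fin n) (hx : G.dist b x ≤ G.dist b v) :
    x ∈ done ++ v :: rest := by
  induction hk : G.dist b x using Nat.strong_induction_on generalizing x with
  | _ k ih =>
    by_cases hxb : x = b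
    · exact hxb ▸ I.base_mem
    · obtain ⟨d, hd⟩ := hG.1.exists_desc hxb
      have h2 := hd.2
      have h3 := ih (G.dist b d) (by omega) d (by omega) rfl
      have h4 := I.sorted
      rw [List.pairwise_append] at h4
      have hdd : d ∈ done := by
        rcases List.mem_append.1 h3 with h5 | h5
        · exact h5
        · rcases List.mem_cons.1 h5 with rfl | h6
          · omega
          · have := (List.pairwise_cons.1 h4.2.1).1 d h6
            omega
      exact I.scan_found d x ((hS d x).2 ⟨hdd, hd.1.symm⟩)

lemma mem_done_of_lt (hG : G.IsMedian) {v : Fin n} {rest : List (Fin n)}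
    (I : SearchInv G b ix done (v :: rest) S flag par lo hi lab num)
    (hS : ∀ d x, S d x ↔ d ∈ done ∧ G.Adj d x) (x : Fin n) (hx : G.dist b x < G.dist b v) :
    x ∈ done := by
  rcases List.mem_append.1 (I.found_of_le hG hS x hx.le) with h | h
  · exact h
  · have h4 := I.sorted
    rw [List.pairwise_append] at h4
    rcases List.mem_cons.1 h with rfl | h6
    · omega
    · have := (List.pairwise_cons.1 h4.2.1).1 x h6
      omega

lemma mem_done (hG : G.IsMedian) (I : SearchInv G b ix done [] S flag par lo hi lab num)
    (hS : ∀ d x, S d x ↔ d ∈ done ∧ G.Adj d x) (x : Fin n) : x ∈ done := by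
  induction hk : G.dist b x using Nat.strong_induction_on generalizing x with
  | _ k ih =>
    by_cases hxb : x = b
    · rw [hxb]; simpa using I.base_mem
    · obtain ⟨d, hd⟩ := hG.1.exists_desc hxb
      have h2 := hd.2
      have h3 := ih (G.dist b d) (by omega) d rfl
      simpa using I.scan_found d x ((hS d x).2 ⟨h3, hd.1.symm⟩)

lemma isRoot_rootOf (hG : G.IsMedian) {x d : Fin n} (h : G.Desc b x d) :
    ∃ s, G.IsRoot b (G.rootOf b x d) s := by
  obtain ⟨s, h1, -⟩ := hG.rootOf_spec h
  exact ⟨s, h1⟩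

lemma desc_ne_base {x d : Fin n} (h : G.Desc b x d) : x ≠ b := by
  rintro rfl
  have := h.2
  simp at this

lemma tight_lt (hG : G.IsMedian) (I : SearchInv G b ix done queue S flag par lo hi lab num)
    {v u w : Fin n} (hu : G.Desc b v u) (hud : u ∈ done) (hr : G.rootOf b v u ∈ done)
    (hw : G.Desc b u w) :
    hi (G.rootOf b u w) < hi (G.rootOf b v u) ∨
      ∃ m, m ≠ u ∧ G.Desc b v m ∧ G.rootOf b u w = G.rootOf b v m := by
  by_cases ht : ∀ m, G.Adj v m → G.Adj m w → m = u
  · left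
    obtain ⟨s, hs⟩ := isRoot_rootOf hG hw
    obtain ⟨s', hs'⟩ := isRoot_rootOf hG hu
    exact I.root_mono _ (I.rootOf_done u hud w hw) _ hr _ _ hs hs' (hG.dist_rootOf_lt hu hw ht)
  · right
    push Not at ht
    obtain ⟨m, h1, h2, h3⟩ := ht
    have hu2 := hu.2
    have hw2 := hw.2
    have e1 := hG.dist_adj b h1
    have e2 := hG.dist_adj b h2
    have hm : G.Desc b v m := ⟨h1, by omega⟩
    have hmw : G.Desc b m w := ⟨h2, by omega⟩
    exact ⟨m, h3, hm, (hG.rootOf_square h3 hm hu hmw hw).symm⟩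

/-- A lower neighbour of `v` other than the one with the greatest class number has its parent
on the opposite side of the square formed with that one. -/
lemma par_desc (hG : G.IsMedian) (I : SearchInv G b ix done queue S flag par lo hi lab num)
    {v p u : Fin n} (hp : G.Desc b v p)
    (hmax : ∀ d, G.Desc b v d → d ≠ p → hi (G.rootOf b v d) < hi (G.rootOf b v p))
    (hu : G.Desc b v u) (hup : u ≠ p) (hud : u ∈ done) (hr : G.rootOf b v u ∈ done) :
    ∃ z : Fin n, par u = z ∧ G.Desc b u z ∧ G.Desc b p z ∧ hi u = hi (G.rootOf b v p) := by
  obtain ⟨z, hz1, hz2⟩ := hG.quadrangle hup hu hp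
  have hzr := hG.rootOf_square hup.symm hp hu hz2 hz1
  obtain ⟨f, hf1, hf2, hf3, hf4⟩ := I.fin u hud (desc_ne_base hz1)
  have hfz : f = z := by
    by_contra hne
    have h1 := hf4 z hz1 (Ne.symm hne)
    rw [← hzr] at h1
    rcases I.tight_lt hG hu hud hr hf2 with h2 | ⟨m, -, hm2, hm3⟩
    · have := hmax u hu hup
      omega
    · rw [hm3] at h1
      by_cases hmp : m = p
      · rw [hmp] at h1; omega
      · have := hmax m hm2 hmp
        omega
  subst hfz
  exact ⟨f, hf1, hz1, hz2, by rw [hf3, hzr]⟩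

lemma hi_lt (hG : G.IsMedian) (I : SearchInv G b ix done queue S flag par lo hi lab num)
    {v p : Fin n} (hp : G.Desc b v p)
    (hmax : ∀ d, G.Desc b v d → d ≠ p → hi (G.rootOf b v d) < hi (G.rootOf b v p))
    (hpb : p ≠ b) (hpd : p ∈ done) (hr : G.rootOf b v p ∈ done) :
    hi p < hi (G.rootOf b v p) := by
  obtain ⟨f, hf1, hf2, hf3, -⟩ := I.fin p hpd hpb
  rw [hf3]
  rcases I.tight_lt hG hp hpd hr hf2 with h2 | ⟨m, hm1, hm2, hm3⟩
  · exact h2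
  · rw [hm3]
    exact hmax m hm2 hm1

lemma pop_aux (hG : G.IsMedian) {v : Fin n} {rest : List (Fin n)}
    (I : SearchInv G b ix done (v :: rest) S flag par lo hi lab num)
    (hS : ∀ d x, S d x ↔ d ∈ done ∧ G.Adj d x) {hi' : ℕ → ℕ} {num' : ℕ}
    (hoff : ∀ x : Fin n, x ≠ v → hi' x = hi x)
    (hfin : v ≠ b → ∃ p : Fin n, par v = p ∧ G.Desc b v p ∧ hi' v = hi' (G.rootOf b v p) ∧
      ∀ d, G.Desc b v d → d ≠ p → hi' (G.rootOf b v d) < hi' (G.rootOf b v p))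
    (hroot : ((∀ s, ¬ G.IsRoot b v s) ∧ num' = num) ∨
      ((∃ s, G.IsRoot b v s) ∧ hi' v = num ∧ num' = num + 1)) :
    SearchInv G b ix (done ++ [v]) rest S (Function.update flag v 2) par lo hi' lab num' := by
  have hnd : (done ++ [v] ++ rest).Nodup := by simpa using I.nodup
  have hsort : (done ++ [v] ++ rest).Pairwise (fun x y => G.dist b x ≤ G.dist b y) := by
    simpa using I.sorted
  have hnd2 := I.nodup
  rw [List.nodup_append] at hnd2
  have hvd : ∀ x ∈ done, x ≠ v := fun x hx => hnd2.2.2 x hx v (by simp)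
  have hvr : ∀ x ∈ rest, x ≠ v := by
    rintro x hx rfl
    exact (List.nodup_cons.1 hnd2.2.1).1 hx
  have hsort2 := I.sorted
  rw [List.pairwise_append] at hsort2
  have hle : ∀ x ∈ done, G.dist b x ≤ G.dist b v := fun x hx => hsort2.2.2 x hx v (by simp)
  have hSv : ∀ d x, S d x → d ≠ v := fun d x h => hvd d ((hS d x).1 h).1
  have hnum : num ≤ num' := by omega
  have hcases : ∀ r ∈ done ++ [v], ∀ s, G.IsRoot b r s →
      (r ∈ done ∧ hi' r = hi r) ∨ (r = v ∧ hi' v = num ∧ num' = num + 1) := by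
    intro r hr s hs
    rcases List.mem_append.1 hr with h | h
    · exact Or.inl ⟨h, hoff r (hvd r h)⟩
    · obtain rfl := List.mem_singleton.1 h
      rcases hroot with h1 | h1
      · exact absurd hs (h1.1 s)
      · exact Or.inr ⟨rfl, h1.2⟩
  exact
  { nodup := hnd
    sorted := hsort
    base_mem := by simpa using I.base_mem
    flag_done := by
      intro x hx
      by_cases hxv : x = v
      · simp [hxv]
      · rw [update_val_ne _ _ hxv]
        exact I.flag_done x (by simpa [hxv] using hx)
    flag_queue := by
      intro x hx
      rw [update_val_ne _ _ (hvr x hx)]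
      exact I.flag_queue x (by simp [hx])
    flag_new := by
      intro x hx hx'
      have hxv : x ≠ v := by rintro rfl; simp at hx
      rw [update_val_ne _ _ hxv]
      exact I.flag_new x (fun h => hx (by simp [h])) (by simp [hx', hxv])
    scan_done := fun d x h => ⟨by simp [(I.scan_done d x h).1], (I.scan_done d x h).2⟩
    scan_found := fun d x h => by simpa using I.scan_found d x h
    par_base := I.par_base
    base_ne := by
      intro hb
      rw [hoff b (hvr b hb)]
      exact I.base_ne (by simp [hb])
    acc := by
      intro x hx hxb
      obtain ⟨p, h1, h2, h3, h4, d, h5, h6⟩ := I.acc x (by simp [hx]) hxb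
      refine ⟨p, h1, h2, ?_, ?_, d, h5, ?_⟩
      · rw [hoff p (hSv p x h2), h3]
      · intro d hd
        rw [hoff d (hSv d x hd), hoff x (hvr x hx)]
        exact h4 d hd
      · rw [hoff d (hSv d x h5), hoff x (hvr x hx), h6]
    rootOf_done := by
      intro x hx d hd
      rcases List.mem_append.1 hx with h | h
      · exact List.mem_append_left _ (I.rootOf_done x h d hd)
      · obtain rfl := List.mem_singleton.1 h
        obtain ⟨s, -, -, -, h4⟩ := hG.rootOf_spec hd
        rcases h4 with h4 | h4
        · simp [h4]
        · exact List.mem_append_left _ (I.mem_done_of_lt hG hS _ h4)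
    fin := by
      intro x hx hxb
      rcases List.mem_append.1 hx with h | h
      · obtain ⟨p, h1, h2, h3, h4⟩ := I.fin x h hxb
        have hp := hoff _ (hvd _ (I.rootOf_done x h p h2))
        refine ⟨p, h1, h2, ?_, fun d hd hdp => ?_⟩
        · rw [hp, hoff x (hvd x h), h3]
        · rw [hp, hoff _ (hvd _ (I.rootOf_done x h d hd))]
          exact h4 d hd hdp
      · obtain rfl := List.mem_singleton.1 h
        exact hfin hxb
    root_lt := by
      intro r hr s hs
      rcases hcases r hr s hs with ⟨h1, h2⟩ | ⟨rfl, h2, h3⟩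
      · have := I.root_lt r h1 s hs
        omega
      · omega
    root_mono := by
      intro r hr r' hr' s s' hs hs' hlt
      rcases hcases r hr s hs with ⟨h1, h2⟩ | ⟨rfl, h2, h3⟩ <;>
        rcases hcases r' hr' s' hs' with ⟨h1', h2'⟩ | ⟨rfl, h2', h3'⟩
      · rw [h2, h2']
        exact I.root_mono r h1 r' h1' s s' hs hs' hlt
      · have := I.root_lt r h1 s hs
        omega
      · have := hle r' h1'
        omega
      · omega
    root_inj := by
      intro r hr r' hr' s s' hs hs' heq
      rcases hcases r hr s hs with ⟨h1, h2⟩ | ⟨rfl, h2, h3⟩ <;>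
        rcases hcases r' hr' s' hs' with ⟨h1', h2'⟩ | ⟨rfl, h2', h3'⟩
      · exact I.root_inj r h1 r' h1' s s' hs hs' (by omega)
      · have := I.root_lt r h1 s hs
        omega
      · have := I.root_lt r' h1' s' hs'
        omega
      · rfl
    root_surj := by
      intro k hk
      by_cases hkn : k < num
      · obtain ⟨r, h1, s, h2, h3⟩ := I.root_surj k hkn
        exact ⟨r, by simp [h1], s, h2, by rw [hoff r (hvd r h1), h3]⟩
      · rcases hroot with h | ⟨⟨s, hs⟩, h2, h3⟩
        · omega
        · exact ⟨v, by simp, s, hs, by omega⟩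
    num_le := by
      have := I.num_le
      simp only [List.length_append, List.length_cons, List.length_nil]
      omega
    lab_eq := by
      intro x u hx hd
      rw [hoff _ (hvd _ (I.rootOf_done x (I.scan_done x u hx).1 u hd))]
      exact I.lab_eq x u hx hd }

/-- Removing the head `v` of the queue preserves the invariant, if `hi v` is replaced by a new
number whenever `lo v` and `hi v` agree. -/
lemma pop (hG : G.IsMedian) {v : Fin n} {rest : List (Fin n)}
    (I : SearchInv G b ix done (v :: rest) S flag par lo hi lab num)
    (hS : ∀ d x, S d x ↔ d ∈ done ∧ G.Adj d x) :
    (lo v = hi v → SearchInv G b ix (done ++ [v]) rest S (Function.update flag v 2) par lo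
      (Function.update hi v num) lab (num + 1)) ∧
    (lo v ≠ hi v → SearchInv G b ix (done ++ [v]) rest S (Function.update flag v 2) par lo hi
      lab num) := by
  by_cases hvb : v = b
  · have h1 : ∀ s, ¬ G.IsRoot b v s := fun s hs => desc_ne_base hs.1 hvb
    refine ⟨fun h => absurd (hvb ▸ h) (I.base_ne (by simp [hvb])), fun _ => ?_⟩
    exact I.pop_aux hG hS (fun _ _ => rfl) (fun h => absurd hvb h) (Or.inl ⟨h1, rfl⟩)
  have hSD : ∀ d, S d v ↔ G.Desc b v d := by
    intro d
    rw [hS]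
    constructor
    · rintro ⟨h1, h2⟩
      have h3 := I.sorted
      rw [List.pairwise_append] at h3
      have h4 := h3.2.2 d h1 v (by simp)
      have h5 := hG.dist_adj b h2
      exact ⟨h2.symm, by omega⟩
    · intro h
      have := h.2
      exact ⟨I.mem_done_of_lt hG hS d (by omega), h.1.symm⟩
  obtain ⟨q, hq1, hq2, hq3, hq4, t, ht1, ht2⟩ := I.acc v (by simp) hvb
  by_cases hroot : ∀ d, G.Desc b v d → d = q
  · have hr : G.IsRoot b v q := ⟨(hSD q).1 hq2, hroot⟩
    have htq := hroot t ((hSD t).1 ht1)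
    subst htq
    refine ⟨fun _ => ?_, fun h => absurd (hq3.trans ht2) h⟩
    refine I.pop_aux hG hS (fun x hx => update_val_ne _ _ hx) (fun _ => ?_)
      (Or.inr ⟨⟨t, hr⟩, by simp, rfl⟩)
    refine ⟨t, hq1, hr.1, ?_, fun d hd hdt => absurd (hroot d hd) hdt⟩
    rw [hG.rootOf_root hr]
  · push Not at hroot
    obtain ⟨q', hq'1, hq'2⟩ := hroot
    have hnr : ∀ s, ¬ G.IsRoot b v s := fun s hs =>
      hq'2 ((hs.2 q' hq'1).trans (hs.2 q ((hSD q).1 hq2)).symm)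
    have hrd : ∀ d, G.Desc b v d → G.rootOf b v d ∈ done := by
      intro d hd
      obtain ⟨s, h1, -, -, h4⟩ := hG.rootOf_spec hd
      rcases h4 with h4 | h4
      · exact absurd (h4 ▸ h1) (hnr s)
      · exact I.mem_done_of_lt hG hS _ h4
    obtain ⟨p, hp, hpmax⟩ : ∃ p, G.Desc b v p ∧
        ∀ d, G.Desc b v d → hi (G.rootOf b v d) ≤ hi (G.rootOf b v p) := by
      classical
      obtain ⟨p, h1, h2⟩ := Finset.exists_max_image
        (Finset.univ.filter (fun d => G.Desc b v d)) (fun d => hi (G.rootOf b v d))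
        ⟨q', by simpa using hq'1⟩
      exact ⟨p, by simpa using h1, fun d hd => h2 d (by simpa using hd)⟩
    have hmax : ∀ d, G.Desc b v d → d ≠ p → hi (G.rootOf b v d) < hi (G.rootOf b v p) := by
      intro d hd hdp
      refine lt_of_le_of_ne (hpmax d hd) (fun he => hdp ?_)
      obtain ⟨s, hs⟩ := isRoot_rootOf hG hd
      obtain ⟨s', hs'⟩ := isRoot_rootOf hG hp
      exact hG.rootOf_injective hd hp (I.root_inj _ (hrd d hd) _ (hrd p hp) s s' hs hs' he)
    have hdone : ∀ d, G.Desc b v d → d ∈ done := fun d hd => ((hS d v).1 ((hSD d).2 hd)).1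
    obtain ⟨y, hy1, hy2⟩ : ∃ y, G.Desc b v y ∧ y ≠ p := by
      by_cases h : q' = p
      · exact ⟨q, (hSD q).1 hq2, fun h' => hq'2 (h.trans h'.symm)⟩
      · exact ⟨q', hq'1, h⟩
    have heq : ∀ d, G.Desc b v d → d ≠ p → hi d = hi (G.rootOf b v p) := by
      intro d hd hdp
      obtain ⟨z, -, -, -, h⟩ := I.par_desc hG hp hmax hd hdp (hdone d hd) (hrd d hd)
      exact h
    have hpb : p ≠ b := by
      obtain ⟨z, -, hz⟩ := hG.quadrangle hy2 hy1 hp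
      exact desc_ne_base hz
    have hplt := I.hi_lt hG hp hmax hpb (hdone p hp) (hrd p hp)
    have h1 := hq4 p ((hSD p).2 hp)
    have h2 := hq4 y ((hSD y).2 hy1)
    have h3 := heq y hy1 hy2
    have hqp : q = p := by
      by_contra hne
      have := heq q ((hSD q).1 hq2) hne
      omega
    have hhi : hi v = hi (G.rootOf b v p) := by
      by_cases htp : t = p
      · rw [htp] at ht2; omega
      · have := heq t ((hSD t).1 ht1) htp
        omega
    subst hqp
    refine ⟨fun h => absurd h (by omega), fun _ => ?_⟩
    exact I.pop_aux hG hS (fun _ _ => rfl) (fun _ => ⟨q, hq1, hp, hhi, hmax⟩)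
      (Or.inl ⟨hnr, rfl⟩)

end SearchInv

/-- The invariant while the neighbours of the vertex `v`, the last one removed from the queue, are
being scanned. -/
structure ScanInv (G : SimpleGraph (Fin n)) (b : Fin n) (ix : Fin n → Fin n → ℕ)
    (done queue : List (Fin n)) (v : Fin n) (S : Fin n → Fin n → Prop)
    (flag par lo hi lab : ℕ → ℕ) (num : ℕ) : Prop
    extends SearchInv G b ix done queue S flag par lo hi lab num where
  mem : v ∈ done
  desc_done : ∀ d, G.Desc b v d → d ∈ done
  dist_le : ∀ d ∈ done, G.dist b d ≤ G.dist b v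
  le_dist : ∀ x ∈ queue, G.dist b v ≤ G.dist b x
  near : ∀ x ∈ queue, G.dist b x ≤ G.dist b v + 1
  scanned : ∀ d ∈ done, d ≠ v → ∀ x, G.Adj d x → S d x

namespace ScanInv

variable {G : SimpleGraph (Fin n)} {b v u : Fin n} {ix : Fin n → Fin n → ℕ}
  {done queue : List (Fin n)} {S : Fin n → Fin n → Prop} {flag par lo hi lab : ℕ → ℕ} {num : ℕ}

lemma of_pop (hG : G.IsMedian) {v : Fin n} {rest : List (Fin n)} {flag' hi' : ℕ → ℕ} {num' : ℕ}
    (I : SearchInv G b ix done (v :: rest) S flag par lo hi lab num)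
    (hS : ∀ d x, S d x ↔ d ∈ done ∧ G.Adj d x)
    (hnear : ∀ x ∈ v :: rest, ∀ y ∈ v :: rest, G.dist b y ≤ G.dist b x + 1)
    (I' : SearchInv G b ix (done ++ [v]) rest S flag' par lo hi' lab num') :
    ScanInv G b ix (done ++ [v]) rest v S flag' par lo hi' lab num' where
  toSearchInv := I'
  mem := by simp
  desc_done := fun d hd => by
    have := hd.2
    exact List.mem_append_left _ (I.mem_done_of_lt hG hS d (by omega))
  dist_le := by
    intro d hd
    have h := I.sorted
    rw [List.pairwise_append] at h
    rcases List.mem_append.1 hd with h1 | h1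
    · exact h.2.2 d h1 v (by simp)
    · rw [List.mem_singleton.1 h1]
  le_dist := by
    intro x hx
    have h := I.sorted
    rw [List.pairwise_append] at h
    exact (List.pairwise_cons.1 h.2.1).1 x hx
  near := fun x hx => hnear v (by simp) x (by simp [hx])
  scanned := by
    intro d hd hdv x hx
    exact (hS d x).2 ⟨by simpa [hdv] using hd, hx⟩

lemma near_queue (I : ScanInv G b ix done queue v S flag par lo hi lab num) :
    ∀ x ∈ queue, ∀ y ∈ queue, G.dist b y ≤ G.dist b x + 1 := by
  intro x hx y hy
  have := I.near y hy
  have := I.le_dist x hx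
  omega

lemma scan_up_aux (hG : G.IsMedian) (I : ScanInv G b ix done queue v S flag par lo hi lab num)
    (huv : G.Adj v u) (hu : u ∉ done) {queue' : List (Fin n)} {flag' par' lo' hi' : ℕ → ℕ}
    (hq : (u ∈ queue ∧ queue' = queue) ∨ (u ∉ queue ∧ queue' = queue ++ [u]))
    (hflag : ∀ x : Fin n, x ≠ u → flag' x = flag x) (hflagu : flag' u = 1)
    (hpar : ∀ x : Fin n, x ≠ u → par' x = par x) (hlo : ∀ x : Fin n, x ≠ u → lo' x = lo x)
    (hhi : ∀ x : Fin n, x ≠ u → hi' x = hi x)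
    (hacc : ∃ p : Fin n, par' u = p ∧ (S p u ∨ p = v) ∧ lo' u = hi p ∧
      (∀ d, S d u ∨ d = v → lo' u ≤ hi d ∧ hi d ≤ hi' u) ∧
      ∃ d, (S d u ∨ d = v) ∧ hi d = hi' u) :
    ScanInv G b ix done queue' v (fun d x => S d x ∨ d = v ∧ x = u) flag' par' lo' hi' lab
      num := by
  have hdesc : G.Desc b u v := by
    rcases hG.desc_or_desc (b := b) huv with h | h
    · exact absurd (I.desc_done u h) hu
    · exact h
  have hub : u ≠ b := SearchInv.desc_ne_base hdesc
  have hud : ∀ d ∈ done, d ≠ u := by rintro d hd rfl; exact hu hd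
  have hhid : ∀ d ∈ done, hi' d = hi d := fun d hd => hhi d (hud d hd)
  have hmem : ∀ x, x ∈ queue' ↔ x ∈ queue ∨ x = u := by
    rcases hq with ⟨h1, rfl⟩ | ⟨h1, rfl⟩
    · intro x
      refine ⟨Or.inl, ?_⟩
      rintro (h | rfl)
      exacts [h, h1]
    · simp
  have hvu : ∀ d, S d u ∨ d = v → d ∈ done := by
    rintro d (h | rfl)
    exacts [(I.scan_done d u h).1, I.mem]
  exact
  { nodup := by
      rcases hq with ⟨h1, rfl⟩ | ⟨h1, rfl⟩
      · exact I.nodup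
      · have := I.nodup
        rw [← List.append_assoc, List.nodup_append]
        refine ⟨this, by simp, ?_⟩
        rintro x hx y hy rfl
        rw [List.mem_singleton.1 hy] at hx
        simp [hu, h1] at hx
    sorted := by
      rcases hq with ⟨h1, rfl⟩ | ⟨h1, rfl⟩
      · exact I.sorted
      · have h2 := I.sorted
        rw [← List.append_assoc, List.pairwise_append]
        refine ⟨h2, by simp, ?_⟩
        intro x hx y hy
        rw [List.mem_singleton.1 hy, ← hdesc.2]
        rcases List.mem_append.1 hx with h3 | h3
        · have := I.dist_le x h3
          omega
        · exact I.near x h3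
    base_mem := by
      have := I.base_mem
      simp only [List.mem_append, hmem] at this ⊢
      tauto
    flag_done := by
      intro x hx
      rw [hflag x (hud x hx)]
      exact I.flag_done x hx
    flag_queue := by
      intro x hx
      by_cases hxu : x = u
      · rw [hxu, hflagu]
      · rw [hflag x hxu]
        exact I.flag_queue x (by simpa [hmem, hxu] using hx)
    flag_new := by
      intro x hx hx'
      rw [hmem] at hx'
      push Not at hx'
      rw [hflag x hx'.2]
      exact I.flag_new x hx hx'.1
    scan_done := by
      rintro d x (h | ⟨rfl, rfl⟩)
      · exact I.scan_done d x h
      · exact ⟨I.mem, huv⟩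
    scan_found := by
      rintro d x (h | ⟨rfl, rfl⟩)
      · have := I.scan_found d x h
        simp only [List.mem_append, hmem] at this ⊢
        tauto
      · simp [hmem]
    par_base := by rw [hpar b hub.symm, I.par_base]
    base_ne := by
      intro hb
      rw [hlo b hub.symm, hhi b hub.symm]
      exact I.base_ne (by simpa [hmem, hub.symm] using hb)
    acc := by
      intro x hx hxb
      by_cases hxu : x = u
      · subst hxu
        obtain ⟨p, h1, h2, h3, h4, d, h5, h6⟩ := hacc
        refine ⟨p, h1, by simpa using h2, ?_, ?_, d, by simpa using h5, ?_⟩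
        · rw [hhid p (hvu p h2), h3]
        · intro d hd
          have hd : S d x ∨ d = v := by simpa using hd
          rw [hhid d (hvu d hd)]
          exact h4 d hd
        · rw [hhid d (hvu d h5), h6]
      · obtain ⟨p, h1, h2, h3, h4, d, h5, h6⟩ := I.acc x (by simpa [hmem, hxu] using hx) hxb
        refine ⟨p, by rw [hpar x hxu, h1], Or.inl h2, ?_, ?_, d, Or.inl h5, ?_⟩
        · rw [hlo x hxu, hhid p (I.scan_done p x h2).1, h3]
        · rintro d (hd | ⟨-, h⟩)
          · rw [hlo x hxu, hhi x hxu, hhid d (I.scan_done d x hd).1]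
            exact h4 d hd
          · exact absurd h hxu
        · rw [hhi x hxu, hhid d (I.scan_done d x h5).1, h6]
    rootOf_done := I.rootOf_done
    fin := by
      intro x hx hxb
      obtain ⟨p, h1, h2, h3, h4⟩ := I.fin x hx hxb
      have hp := hhid _ (I.rootOf_done x hx p h2)
      refine ⟨p, by rw [hpar x (hud x hx), h1], h2, by rw [hp, hhid x hx, h3],
        fun d hd hdp => ?_⟩
      rw [hp, hhid _ (I.rootOf_done x hx d hd)]
      exact h4 d hd hdp
    root_lt := fun r hr s hs => by rw [hhid r hr]; exact I.root_lt r hr s hs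
    root_mono := fun r hr r' hr' s s' hs hs' h => by
      rw [hhid r hr, hhid r' hr']; exact I.root_mono r hr r' hr' s s' hs hs' h
    root_inj := fun r hr r' hr' s s' hs hs' h => by
      rw [hhid r hr, hhid r' hr'] at h; exact I.root_inj r hr r' hr' s s' hs hs' h
    root_surj := fun k hk => by
      obtain ⟨r, h1, s, h2, h3⟩ := I.root_surj k hk
      exact ⟨r, h1, s, h2, by rw [hhid r h1, h3]⟩
    num_le := I.num_le
    lab_eq := by
      rintro x y (h | ⟨rfl, rfl⟩) hd
      · rw [hhid _ (I.rootOf_done x (I.scan_done x y h).1 y hd)]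
        exact I.lab_eq x y h hd
      · exact absurd (I.desc_done y hd) hu
    mem := I.mem
    desc_done := I.desc_done
    dist_le := I.dist_le
    le_dist := by
      intro x hx
      rcases (hmem x).1 hx with h | rfl
      · exact I.le_dist x h
      · have := hdesc.2
        omega
    near := by
      intro x hx
      rcases (hmem x).1 hx with h | rfl
      · exact I.near x h
      · exact hdesc.2.ge
    scanned := fun d hd hdv x hx => Or.inl (I.scanned d hd hdv x hx) }

lemma scan_new (hG : G.IsMedian) (I : ScanInv G b ix done queue v S flag par lo hi lab num)
    (huv : G.Adj v u) (hu : flag u = 0) :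
    ScanInv G b ix done (queue ++ [u]) v (fun d x => S d x ∨ d = v ∧ x = u)
      (Function.update flag u 1) (Function.update par u v) (Function.update lo u (hi v))
      (Function.update hi u (hi v)) lab num := by
  have h1 : u ∉ done := fun h => by rw [I.flag_done u h] at hu; omega
  have h2 : u ∉ queue := fun h => by rw [I.flag_queue u h] at hu; omega
  have h3 : ∀ d, ¬ S d u := fun d h => by
    have := I.scan_found d u h
    simp [h1, h2] at this
  refine I.scan_up_aux hG huv h1 (Or.inr ⟨h2, rfl⟩) (fun x hx => update_val_ne _ _ hx) (by simp)
    (fun x hx => update_val_ne _ _ hx) (fun x hx => update_val_ne _ _ hx)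
    (fun x hx => update_val_ne _ _ hx) ⟨v, by simp, Or.inr rfl, by simp, ?_, v, Or.inr rfl, by simp⟩
  rintro d (h | rfl)
  · exact absurd h (h3 d)
  · simp

lemma scan_queued (hG : G.IsMedian) (I : ScanInv G b ix done queue v S flag par lo hi lab num)
    (huv : G.Adj v u) (hu : flag u = 1) :
    ScanInv G b ix done queue v (fun d x => S d x ∨ d = v ∧ x = u) flag
      (if hi v < lo u then Function.update par u v else par)
      (if hi v < lo u then Function.update lo u (hi v) else lo)
      (if hi u < hi v then Function.update hi u (hi v) else hi) lab num := by
  have h1 : u ∉ done := fun h => by rw [I.flag_done u h] at hu; omega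
  have h2 : u ∈ queue := by
    by_contra h
    rw [I.flag_new u h1 h] at hu
    omega
  have hub : u ≠ b := by
    rcases hG.desc_or_desc (b := b) huv with h | h
    · exact absurd (I.desc_done u h) h1
    · exact SearchInv.desc_ne_base h
  refine I.scan_up_aux hG huv h1 (Or.inl ⟨h2, rfl⟩) (fun x hx => rfl) hu
    (fun x hx => ?_) (fun x hx => ?_) (fun x hx => ?_) ?_
  · split_ifs
    exacts [update_val_ne _ _ hx, rfl]
  · split_ifs
    exacts [update_val_ne _ _ hx, rfl]
  · split_ifs
    exacts [update_val_ne _ _ hx, rfl]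
  · obtain ⟨p, k1, k2, k3, k4, d, k5, k6⟩ := I.acc u h2 hub
    have k7 := k4 d k5
    by_cases hc1 : hi v < lo u <;> by_cases hc2 : hi u < hi v <;>
      simp only [hc1, hc2, if_true, if_false, Function.update_self]
    · omega
    · refine ⟨v, rfl, Or.inr rfl, rfl, ?_, d, Or.inl k5, k6⟩
      rintro d (h | rfl)
      · have := k4 d h
        omega
      · omega
    · refine ⟨p, k1, Or.inl k2, k3, ?_, v, Or.inr rfl, rfl⟩
      rintro d (h | rfl)
      · have := k4 d h
        omega
      · omega
    · refine ⟨p, k1, Or.inl k2, k3, ?_, d, Or.inl k5, k6⟩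
      rintro d (h | rfl)
      · exact k4 d h
      · omega

lemma desc_of_flag (hG : G.IsMedian) (I : ScanInv G b ix done queue v S flag par lo hi lab num)
    (huv : G.Adj v u) (hu : flag u ≠ 0) (hu' : flag u ≠ 1) : u ∈ done ∧ G.Desc b v u := by
  have h1 : u ∈ done := by
    by_contra h
    by_cases h' : u ∈ queue
    · exact hu' (I.flag_queue u h')
    · exact hu (I.flag_new u h h')
  have := I.dist_le u h1
  have := hG.dist_adj b huv
  exact ⟨h1, huv, by omega⟩

lemma scan_down_aux (hix : ∀ x y x' y', G.Desc b x y → G.Desc b x' y' →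
      ix x y = ix x' y' → x = x' ∧ y = y')
    (I : ScanInv G b ix done queue v S flag par lo hi lab num)
    (huv : G.Desc b v u) {c : ℕ} (hc : c = hi (G.rootOf b v u)) :
    ScanInv G b ix done queue v (fun d x => S d x ∨ d = v ∧ x = u) flag par lo hi
      (Function.update lab (ix v u) c) num :=
  { I with
    scan_done := by
      rintro d x (h | ⟨rfl, rfl⟩)
      · exact I.scan_done d x h
      · exact ⟨I.mem, huv.1⟩
    scan_found := by
      rintro d x (h | ⟨rfl, rfl⟩)
      · exact I.scan_found d x h
      · exact List.mem_append_left _ (I.desc_done _ huv)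
    acc := by
      intro x hx hxb
      have hxu : x ≠ u := by
        rintro rfl
        have := I.le_dist x hx
        have := huv.2
        omega
      simpa [hxu] using I.acc x hx hxb
    lab_eq := by
      intro x y h hd
      by_cases he : ix x y = ix v u
      · obtain ⟨rfl, rfl⟩ := hix _ _ _ _ hd huv he
        simp [hc]
      · rw [Function.update_of_ne he]
        rcases h with h | ⟨rfl, rfl⟩
        · exact I.lab_eq x y h hd
        · exact absurd rfl he
    scanned := fun d hd hdv x hx => Or.inl (I.scanned d hd hdv x hx) }

/-- Labelling a downward edge `vu`: either `u` is the parent of `v`, or the label is copied from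
the edge joining the parents of `v` and `u`. -/
lemma scan_down (hG : G.IsMedian) (hix : ∀ x y x' y', G.Desc b x y → G.Desc b x' y' →
      ix x y = ix x' y' → x = x' ∧ y = y')
    (I : ScanInv G b ix done queue v S flag par lo hi lab num)
    (huv : G.Adj v u) (hu : flag u ≠ 0) (hu' : flag u ≠ 1) :
    ∃ p : Fin n, par v = p ∧
      (u = p → ScanInv G b ix done queue v (fun d x => S d x ∨ d = v ∧ x = u) flag par lo hi
        (Function.update lab (ix v u) (hi v)) num) ∧
      (u ≠ p → ∃ z : Fin n, par u = z ∧ G.Adj p z ∧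
        ScanInv G b ix done queue v (fun d x => S d x ∨ d = v ∧ x = u) flag par lo hi
          (Function.update lab (ix v u) (lab (ix p z))) num) := by
  obtain ⟨h1, hd⟩ := I.desc_of_flag hG huv hu hu'
  obtain ⟨p, k1, k2, k3, k4⟩ := I.fin v I.mem (SearchInv.desc_ne_base hd)
  refine ⟨p, k1, ?_, fun hup => ?_⟩
  · rintro rfl
    exact I.scan_down_aux hix hd k3
  · obtain ⟨z, hz1, hz2, hz3, -⟩ := I.toSearchInv.par_desc hG k2 k4 hd hup h1
      (I.rootOf_done v I.mem u hd)
    refine ⟨z, hz1, hz3.1, I.scan_down_aux hix hd ?_⟩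
    have hpv : p ≠ v := by
      rintro rfl
      have := k2.2
      omega
    rw [I.lab_eq p z (I.scanned p (I.desc_done p k2) hpv z hz3.1) hz3,
      hG.rootOf_square hup hd k2 hz2 hz3]

end ScanInv

end SimpleGraph

/-! ### A program logic with time bounds -/

namespace WordRAM

namespace State

/-- The state after writing `v` to register `r`. -/
def put (s : State) (r v : ℕ) : State := { s with reg := Function.update s.reg r v }

/-- The state after writing `v` to cell `i` of array `k`. -/
def write (s : State) (k i v : ℕ) : State :=
  { s with arr := Function.update s.arr k (Function.update (s.arr k) i v) }

variable (s : State) (r v k i : ℕ)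

lemma put_reg (r' : ℕ) : (s.put r v).reg r' = if r' = r then v else s.reg r' :=
  Function.update_apply _ _ _ _

lemma put_arr : (s.put r v).arr = s.arr := rfl

lemma write_reg : (s.write k i v).reg = s.reg := rfl

lemma write_arr (k' : ℕ) : (s.write k i v).arr k' =
    if k' = k then Function.update (s.arr k') i v else s.arr k' := by
  simp only [write, Function.update_apply]
  split_ifs with h
  · rw [h]
  · rfl

variable {s r v k i} {w : ℕ}

lemma setReg_eq (h : v < 2 ^ w) : s.setReg w r v = some (s.put r v) := if_pos h

lemma setArr_eq (h : v < 2 ^ w) : s.setArr w k i v = some (s.write k i v) := if_pos h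

lemma Fits.put (hs : s.Fits w) (h : v < 2 ^ w) : (s.put r v).Fits w := by
  refine ⟨fun r' => ?_, hs.2⟩
  rw [put_reg]
  split_ifs
  exacts [h, hs.1 r']

lemma Fits.write (hs : s.Fits w) (h : v < 2 ^ w) : (s.write k i v).Fits w := by
  refine ⟨hs.1, fun k' i' => ?_⟩
  rw [write_arr]
  split_ifs
  · rw [Function.update_apply]
    split_ifs
    exacts [h, hs.2 k' i']
  · exact hs.2 k' i'

end State

/-- `p` terminates from `s` within `k` time units without overflow, and `Q` holds of the final
state and the number of time units left. -/
def Exec (w : ℕ) (p : Program) (s : State) (k : ℕ) (Q : State → ℕ → Prop) : Prop :=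
  s.Fits w → ∃ s' t, Runs w p s s' t ∧ t ≤ k ∧ s'.Fits w ∧ Q s' (k - t)

/-- A condition on the initial state under which a loop-free program ends in a state with property
`Q`. -/
def Program.pre (w : ℕ) : Program → (State → Prop) → State → Prop
  | .skip, Q, s => Q s
  | .instr (.const r c), Q, s => c < 2 ^ w ∧ Q (s.put r c)
  | .instr (.copy r a), Q, s => Q (s.put r (s.reg a))
  | .instr (.add r a b), Q, s => s.reg a + s.reg b < 2 ^ w ∧ Q (s.put r (s.reg a + s.reg b))
  | .instr (.sub r a b), Q, s => Q (s.put r (s.reg a - s.reg b))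
  | .instr (.load r k a), Q, s => Q (s.put r (s.arr k (s.reg a)))
  | .instr (.store k a b), Q, s => Q (s.write k (s.reg a) (s.reg b))
  | .seq p q, Q, s => p.pre w (q.pre w Q) s
  | .ite (.lt a b) p q, Q, s =>
    (s.reg a < s.reg b → p.pre w Q s) ∧ (¬ s.reg a < s.reg b → q.pre w Q s)
  | .ite (.eq a b) p q, Q, s =>
    (s.reg a = s.reg b → p.pre w Q s) ∧ (¬ s.reg a = s.reg b → q.pre w Q s)
  | .loop _ _, _, _ => False

/-- A bound on the running time of a loop-free program. -/
def Program.cost : Program → ℕ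
  | .skip => 1
  | .instr _ => 1
  | .seq p q => p.cost + q.cost
  | .ite _ p q => 1 + (p.cost + q.cost)
  | .loop _ _ => 0

variable {w : ℕ}

lemma Program.exists_runs_of_pre (p : Program) {Q : State → Prop} {s : State} (hs : s.Fits w)
    (h : p.pre w Q s) : ∃ s' t, Runs w p s s' t ∧ t ≤ p.cost ∧ s'.Fits w ∧ Q s' := by
  induction p generalizing s Q with
  | skip => exact ⟨s, 1, .skip s, le_rfl, hs, h⟩
  | instr i =>
    cases i with
    | const r c =>
      exact ⟨_, 1, .instr (State.setReg_eq h.1), le_rfl, hs.put h.1, h.2⟩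
    | copy r a =>
      exact ⟨_, 1, .instr (State.setReg_eq (hs.1 a)), le_rfl, hs.put (hs.1 a), h⟩
    | add r a b =>
      exact ⟨_, 1, .instr (State.setReg_eq h.1), le_rfl, hs.put h.1, h.2⟩
    | sub r a b =>
      have h' : s.reg a - s.reg b < 2 ^ w := (Nat.sub_le _ _).trans_lt (hs.1 a)
      exact ⟨_, 1, .instr (State.setReg_eq h'), le_rfl, hs.put h', h⟩
    | load r k a =>
      exact ⟨_, 1, .instr (State.setReg_eq (hs.2 _ _)), le_rfl, hs.put (hs.2 _ _), h⟩
    | store k a b =>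
      exact ⟨_, 1, .instr (State.setArr_eq (hs.1 b)), le_rfl, hs.write (hs.1 b), h⟩
  | seq p q ihp ihq =>
    obtain ⟨s₁, t₁, h1, h2, h3, h4⟩ := ihp hs h
    obtain ⟨s₂, t₂, h5, h6, h7, h8⟩ := ihq h3 h4
    exact ⟨s₂, t₁ + t₂, .seq h1 h5, Nat.add_le_add h2 h6, h7, h8⟩
  | ite b p q ihp ihq =>
    by_cases hb : b.Holds s
    · have hp : p.pre w Q s := by
        cases b <;> exact h.1 hb
      obtain ⟨s₁, t₁, h1, h2, h3, h4⟩ := ihp hs hp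
      exact ⟨s₁, 1 + t₁, .ite_true hb h1, by simp only [Program.cost]; omega, h3, h4⟩
    · have hq : q.pre w Q s := by
        cases b <;> exact h.2 hb
      obtain ⟨s₁, t₁, h1, h2, h3, h4⟩ := ihq hs hq
      exact ⟨s₁, 1 + t₁, .ite_false hb h1, by simp only [Program.cost]; omega, h3, h4⟩
  | loop b p => exact h.elim

namespace Exec

variable {p q : Program} {s : State} {k : ℕ} {Q Q' : State → ℕ → Prop}

lemma mono (h : Exec w p s k Q) (hQ : ∀ s' k', Q s' k' → Q' s' k') : Exec w p s k Q' := by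
  intro hs
  obtain ⟨s', t, h1, h2, h3, h4⟩ := h hs
  exact ⟨s', t, h1, h2, h3, hQ _ _ h4⟩

lemma of_pre {R : State → Prop} (hk : p.cost ≤ k) (h : p.pre w R s)
    (hQ : ∀ s' k', R s' → k ≤ k' + p.cost → Q s' k') : Exec w p s k Q := by
  intro hs
  obtain ⟨s', t, h1, h2, h3, h4⟩ := p.exists_runs_of_pre hs h
  exact ⟨s', t, h1, h2.trans hk, h3, hQ _ _ h4 (by omega)⟩

lemma seq (h : Exec w p s k (fun s' k' => Exec w q s' k' Q)) : Exec w (.seq p q) s k Q := by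
  intro hs
  obtain ⟨s₁, t₁, h1, h2, h3, h4⟩ := h hs
  obtain ⟨s₂, t₂, h5, h6, h7, h8⟩ := h4 h3
  refine ⟨s₂, t₁ + t₂, .seq h1 h5, by omega, h7, ?_⟩
  rwa [Nat.sub_sub] at h8

/-- A loop is executed within the available time, if every step preserves an invariant of the
state and the remaining time, and the invariant leaves time for evaluating the test. -/
lemma loop {b : Test} {I : State → ℕ → Prop} (h0 : I s k) (hk : ∀ s k, I s k → 1 ≤ k)
    (hstep : ∀ s k, I s k → b.Holds s → Exec w p s (k - 1) I)
    (hexit : ∀ s k, I s k → ¬ b.Holds s → Q s (k - 1)) : Exec w (.loop b p) s k Q := by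
  induction hn : k using Nat.strong_induction_on generalizing s k with
  | _ n ih =>
    subst hn
    intro hs
    have h1 := hk s k h0
    by_cases hb : b.Holds s
    · obtain ⟨s₁, t₁, r1, r2, r3, r4⟩ := hstep s k h0 hb hs
      obtain ⟨s₂, t₂, q1, q2, q3, q4⟩ := ih (k - 1 - t₁) (by omega) r4 rfl r3
      refine ⟨s₂, 1 + t₁ + t₂, .loop_step hb r1 q1, by omega, q3, ?_⟩
      rwa [show k - (1 + t₁ + t₂) = k - 1 - t₁ - t₂ by omega]
    · exact ⟨s, 1, .loop_exit hb, h1, hs, hexit s k h0 hb⟩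

end Exec

end WordRAM

/-! ### The program -/

namespace WordRAM

/-- Sequential composition of a list of programs. -/
def block : List Program → Program
  | [] => .skip
  | p :: l => .seq p (block l)

/-- The neighbour with number `R₁₄` of the vertex `R₉` is scanned. -/
def scanBody : Program := block
  [.instr (.load 10 5 14), .instr (.add 14 14 5), .instr (.load 17 8 10),
    .ite (.eq 17 4)
      (block [.instr (.store 8 10 5), .instr (.store 10 10 9), .instr (.store 11 10 11),
        .instr (.store 12 10 11), .instr (.store 7 8 10), .instr (.add 8 8 5)])
      (.ite (.eq 17 5)
        (block [.instr (.load 17 11 10),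
          .ite (.lt 11 17) (block [.instr (.store 11 10 11), .instr (.store 10 10 9)]) .skip,
          .instr (.load 18 12 10),
          .ite (.lt 18 11) (.instr (.store 12 10 11)) .skip])
        (block [.instr (.add 19 13 10), .instr (.load 19 6 19),
          .ite (.eq 10 16) (.instr (.store 2 19 11))
            (block [.instr (.load 18 10 10), .instr (.add 18 12 18), .instr (.load 18 6 18),
              .instr (.load 18 2 18), .instr (.store 2 19 18)])]))]

/-- The first vertex of the queue is removed. -/
def popBody : Program := block
  [.instr (.load 9 7 7), .instr (.add 7 7 5), .instr (.store 8 9 6), .instr (.load 17 11 9),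
    .instr (.load 11 12 9),
    .ite (.eq 17 11)
      (block [.instr (.copy 11 2), .instr (.store 12 9 2), .instr (.add 2 2 5)]) .skip,
    .instr (.load 16 10 9), .instr (.load 12 3 16), .instr (.load 13 3 9),
    .instr (.copy 14 13), .instr (.load 15 4 9), .instr (.add 15 15 13)]

/-- Breadth-first search from vertex `0`. -/
def search : Program := .loop (.lt 7 8) (.seq popBody (.loop (.lt 14 15) scanBody))

/-- The empty tables for `R₀` vertices, with rows of length `R₃`. -/
def initRows : Program := .loop (.lt 7 0) (block
  [.instr (.store 3 7 8), .instr (.store 4 7 4), .instr (.store 8 7 4), .instr (.add 8 8 3),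
    .instr (.add 7 7 5)])

/-- The tables of the neighbours of all vertices and of the numbers of the edges. -/
def readEdges : Program := .loop (.lt 7 1) (block
  [.instr (.load 9 0 7), .instr (.load 10 1 7), .instr (.load 12 3 9), .instr (.load 13 3 10),
    .instr (.load 17 4 9), .instr (.add 19 12 17), .instr (.store 5 19 10),
    .instr (.add 17 17 5), .instr (.store 4 9 17), .instr (.add 19 12 10),
    .instr (.store 6 19 7),
    .instr (.load 17 4 10), .instr (.add 19 13 17), .instr (.store 5 19 9),
    .instr (.add 17 17 5), .instr (.store 4 10 17), .instr (.add 19 13 9),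
    .instr (.store 6 19 7),
    .instr (.add 7 7 5)])

/-- Constants and the row length `R₀ + 2 R₁`. -/
def initConstants : Program := block
  [.instr (.add 3 0 1), .instr (.add 3 3 1), .instr (.const 4 0), .instr (.const 5 1),
    .instr (.const 6 2), .instr (.const 7 0), .instr (.const 8 0)]

/-- The queue that consists of vertex `0`. -/
def initSearch : Program := block
  [.instr (.const 2 0), .instr (.const 7 0), .instr (.const 8 1), .instr (.store 7 4 4),
    .instr (.store 8 4 5), .instr (.store 10 4 4), .instr (.store 11 4 4), .instr (.store 12 4 5)]

/-- The program that computes the parallelism classes of a median graph. -/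
def thetaProgram : Program :=
  .seq initConstants (.seq initRows (.seq (.instr (.const 7 0)) (.seq readEdges
    (.seq initSearch search))))

/-- The constants and the tables that describe the graph during the search. -/
structure Tables (n K : ℕ) (deg nbr mat : ℕ → ℕ) (s : State) : Prop where
  zero : s.reg 4 = 0
  one : s.reg 5 = 1
  two : s.reg 6 = 2
  row : ∀ v : Fin n, s.arr 3 v = v * K
  deg_eq : s.arr 4 = deg
  nbr_eq : s.arr 5 = nbr
  mat_eq : s.arr 6 = mat

/-- The queue and the vertices removed from it, as they are stored by the search. -/
structure Queue {n : ℕ} (done queue : List (Fin n)) (s : State) : Prop where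
  pos : s.reg 7 = done.length
  tail : s.reg 8 = done.length + queue.length
  ord : ∀ (j : ℕ) (x : Fin n), (done ++ queue)[j]? = some x → s.arr 7 j = x

/-- The registers that are used while the neighbours of `v` are scanned; `j` of them have been
scanned. -/
structure ScanRegs {n : ℕ} (K : ℕ) (deg : ℕ → ℕ) (v p : Fin n) (j : ℕ) (s : State) : Prop where
  vertex : s.reg 9 = v
  num : s.reg 11 = s.arr 12 v
  par_arr : s.arr 10 v = p
  par_reg : s.reg 16 = p
  par_row : s.reg 12 = p * K
  row : s.reg 13 = v * K
  cur : s.reg 14 = v * K + j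
  last : s.reg 15 = v * K + deg v
  le : j ≤ deg v

open SimpleGraph

variable {n K w : ℕ} {G : SimpleGraph (Fin n)} {b : Fin n} {deg nbr mat : ℕ → ℕ}

lemma addr_lt (v : Fin n) {j : ℕ} (hj : j ≤ K) : v * K + j ≤ n * K := by
  have h1 : (v + 1) * K ≤ n * K := Nat.mul_le_mul_right K v.2
  rw [Nat.add_mul] at h1
  omega

lemma scanBody_pre (hG : G.IsMedian) (hw : n * K + n + K + 3 ≤ 2 ^ w) (hnK : n ≤ K)
    {ix : Fin n → Fin n → ℕ} (hixm : ∀ x y : Fin n, ix x y = mat (x * K + y))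
    (hix : ∀ x y x' y', G.Desc b x y → G.Desc b x' y' → ix x y = ix x' y' → x = x' ∧ y = y')
    {s : State} {done queue : List (Fin n)} {v p u : Fin n} {S : Fin n → Fin n → Prop} {j : ℕ}
    (hj : j < deg v) (hdeg : deg v ≤ K) (huv : G.Adj v u) (hu : nbr (v * K + j) = u)
    (hT : Tables n K deg nbr mat s) (hQ : Queue done queue s) (hR : ScanRegs K deg v p j s)
    (I : ScanInv G b ix done queue v S (s.arr 8) (s.arr 10) (s.arr 11) (s.arr 12) (s.arr 2)
      (s.reg 2)) :
    scanBody.pre w (fun s' => ∃ queue', Tables n K deg nbr mat s' ∧ Queue done queue' s' ∧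
      ScanRegs K deg v p (j + 1) s' ∧
      ScanInv G b ix done queue' v (fun d x => S d x ∨ d = v ∧ x = u) (s'.arr 8) (s'.arr 10)
        (s'.arr 11) (s'.arr 12) (s'.arr 2) (s'.reg 2)) s := by
  have hlen := I.length_le
  have a1 := addr_lt v (j := j + 1) (K := K) (by omega)
  have a2 := addr_lt v (j := u) (K := K) (by omega)
  have hvu : (v : ℕ) ≠ u := fun h => huv.ne (Fin.ext h)
  have hT' : ∀ s' : State, s'.reg 4 = s.reg 4 → s'.reg 5 = s.reg 5 → s'.reg 6 = s.reg 6 →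
      s'.arr 3 = s.arr 3 → s'.arr 4 = s.arr 4 → s'.arr 5 = s.arr 5 → s'.arr 6 = s.arr 6 →
      Tables n K deg nbr mat s' := fun s' h1 h2 h3 h4 h5 h6 h7 =>
    ⟨h1.trans hT.zero, h2.trans hT.one, h3.trans hT.two, h4 ▸ hT.row, h5.trans hT.deg_eq,
      h6.trans hT.nbr_eq, h7.trans hT.mat_eq⟩
  have hQ' : ∀ s' : State, s'.reg 7 = s.reg 7 → s'.reg 8 = s.reg 8 → s'.arr 7 = s.arr 7 →
      Queue done queue s' := fun s' h1 h2 h3 =>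
    ⟨h1.trans hQ.pos, h2.trans hQ.tail, h3 ▸ hQ.ord⟩
  have hR' : ∀ s' : State, s'.reg 9 = s.reg 9 → s'.reg 11 = s.reg 11 →
      s'.arr 12 v = s.arr 12 v → s'.arr 10 v = s.arr 10 v → s'.reg 16 = s.reg 16 →
      s'.reg 12 = s.reg 12 → s'.reg 13 = s.reg 13 → s'.reg 14 = s.reg 14 + 1 →
      s'.reg 15 = s.reg 15 → ScanRegs K deg v p (j + 1) s' :=
    fun s' h1 h2 h3 h4 h5 h6 h7 h8 h9 =>
    ⟨h1.trans hR.vertex, by rw [h2, h3, hR.num], h4.trans hR.par_arr, h5.trans hR.par_reg,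
      h6.trans hR.par_row, h7.trans hR.row, by rw [h8, hR.cur, Nat.add_assoc], h9.trans hR.last,
      hj⟩
  have hup := I.scan_queued hG huv
  have hdown := I.scan_down hG hix huv
  simp only [scanBody, block, Program.pre, State.put_reg, State.put_arr, State.write_reg,
    State.write_arr, hT.zero, hT.one, hT.nbr_eq, hT.mat_eq, hR.cur, hR.vertex, hu,
    hR.num, hR.par_reg, hR.par_row, hR.row, Nat.reduceEqDiff, if_true, if_false]
  refine ⟨by omega, fun h0 => ⟨by rw [hQ.tail]; omega, queue ++ [u], ?_, ?_, ?_,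
    I.scan_new hG huv h0⟩, fun h0 => ⟨fun h1 => ?_, fun h1 => ⟨by omega, fun h2 => ?_, fun h2 => ?_⟩⟩⟩
  · apply hT' <;> simp [State.put_reg, State.put_arr, State.write_reg, State.write_arr]
  · refine ⟨?_, ?_, ?_⟩
    · simp [State.put_reg, State.write_reg, hQ.pos]
    · simp [State.put_reg, hQ.tail, Nat.add_assoc]
    · intro i x hx
      simp only [State.put_arr, State.write_arr, Nat.reduceEqDiff, if_true, if_false]
      rw [← List.append_assoc, List.getElem?_append] at hx
      split_ifs at hx with hi
      · rw [Function.update_of_ne, hQ.ord i x hx]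
        rw [hQ.tail]
        simp only [List.length_append] at hi
        omega
      · rw [List.getElem?_singleton] at hx
        split_ifs at hx with hi'
        obtain rfl : u = x := by simpa using hx
        have : i = s.reg 8 := by
          rw [hQ.tail]
          simp only [List.length_append] at hi hi'
          omega
        rw [this, Function.update_self]
  · apply hR' <;>
      simp [State.put_reg, State.put_arr, State.write_reg, State.write_arr, hvu, hR.cur]
  · have hup := hup h1
    refine ⟨fun c1 => ⟨fun c2 => ?_, fun c2 => ?_⟩, fun c1 => ⟨fun c2 => ?_, fun c2 => ?_⟩⟩ <;>
      simp only [c1, c2, if_true, if_false] at hup <;>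
      refine ⟨queue, ?_, ?_, ?_, hup⟩ <;>
      first | apply hT' | apply hQ' | apply hR'
    all_goals
      simp [State.put_reg, State.put_arr, State.write_reg, State.write_arr, hvu, hR.cur]
  · obtain ⟨p', k1, k2, -⟩ := hdown h0 h1
    have hpp : p' = p := Fin.ext (k1.symm.trans hR.par_arr)
    subst hpp
    have k2 := k2 (Fin.ext h2)
    rw [hixm] at k2
    refine ⟨queue, ?_, ?_, ?_, k2⟩ <;>
      first | apply hT' | apply hQ' | apply hR'
    all_goals
      simp [State.put_reg, State.put_arr, State.write_reg, State.write_arr, hR.cur]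
  · obtain ⟨p', k1, -, k2⟩ := hdown h0 h1
    have hpp : p' = p := Fin.ext (k1.symm.trans hR.par_arr)
    subst hpp
    obtain ⟨z, k3, -, k4⟩ := k2 (fun h => h2 (congrArg _ h))
    rw [hixm, hixm] at k4
    have a3 := addr_lt p' (j := z) (K := K) (by omega)
    rw [k3]
    refine ⟨by omega, queue, ?_, ?_, ?_, k4⟩ <;>
      first | apply hT' | apply hQ' | apply hR'
    all_goals
      simp [State.put_reg, State.put_arr, State.write_reg, State.write_arr, hR.cur]

lemma popBody_pre (hG : G.IsMedian) (hw : n * K + n + K + 3 ≤ 2 ^ w)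
    {ix : Fin n → Fin n → ℕ} {s : State} {done rest : List (Fin n)} {v : Fin n}
    {S : Fin n → Fin n → Prop} (hdeg : deg v ≤ K)
    (hT : Tables n K deg nbr mat s) (hQ : Queue done (v :: rest) s)
    (I : SearchInv G b ix done (v :: rest) S (s.arr 8) (s.arr 10) (s.arr 11) (s.arr 12)
      (s.arr 2) (s.reg 2))
    (hS : ∀ d x, S d x ↔ d ∈ done ∧ G.Adj d x)
    (hnear : ∀ x ∈ v :: rest, ∀ y ∈ v :: rest, G.dist b y ≤ G.dist b x + 1) :
    popBody.pre w (fun s' => ∃ p, Tables n K deg nbr mat s' ∧ Queue (done ++ [v]) rest s' ∧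
      ScanRegs K deg v p 0 s' ∧
      ScanInv G b ix (done ++ [v]) rest v S (s'.arr 8) (s'.arr 10) (s'.arr 11) (s'.arr 12)
        (s'.arr 2) (s'.reg 2)) s := by
  have hlen := I.length_le
  have hnum := I.num_le
  rw [List.length_cons] at hlen
  have a1 := addr_lt v hdeg
  have hv : s.arr 7 (s.reg 7) = v := by
    rw [hQ.pos]
    exact hQ.ord _ v (by simp)
  have hpop := I.pop hG hS
  obtain ⟨p, hp⟩ : ∃ p : Fin n, s.arr 10 v = p := by
    by_cases hvb : v = b
    · exact ⟨b, by rw [hvb, I.par_base]⟩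
    · by_cases h : s.arr 11 v = s.arr 12 v
      · obtain ⟨p, hp, -⟩ := (hpop.1 h).fin v (by simp) hvb
        exact ⟨p, hp⟩
      · obtain ⟨p, hp, -⟩ := (hpop.2 h).fin v (by simp) hvb
        exact ⟨p, hp⟩
  simp only [popBody, block, Program.pre, State.put_reg, State.put_arr, State.write_reg,
    State.write_arr, hT.one, hT.two, hT.deg_eq, hT.row, hv, hp, Nat.reduceEqDiff, if_true,
    if_false]
  refine ⟨by rw [hQ.pos]; omega, fun h => ⟨by omega, by omega, p, ?_, ?_, ?_,
    ScanInv.of_pop hG I hS hnear (hpop.1 h)⟩, fun h => ⟨by omega, p, ?_, ?_, ?_,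
    ScanInv.of_pop hG I hS hnear (hpop.2 h)⟩⟩
  · constructor <;> simp [State.put_reg, State.put_arr, State.write_reg, State.write_arr,
      hT.zero, hT.one, hT.two, hT.row, hT.deg_eq, hT.nbr_eq, hT.mat_eq]
  · constructor
    · simp [State.put_reg, State.write_reg, hQ.pos]
    · simp [State.put_reg, State.write_reg, hQ.tail]
      omega
    · simpa [State.put_reg, State.put_arr, State.write_reg, State.write_arr] using hQ.ord
  · constructor <;>
      simp [State.put_reg, State.put_arr, State.write_reg, State.write_arr, hp, Nat.add_comm]
  · constructor <;> simp [State.put_reg, State.put_arr, State.write_reg, State.write_arr,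
      hT.zero, hT.one, hT.two, hT.row, hT.deg_eq, hT.nbr_eq, hT.mat_eq]
  · constructor
    · simp [State.put_reg, State.write_reg, hQ.pos]
    · simp [State.put_reg, State.write_reg, hQ.tail]
      omega
    · simpa [State.put_reg, State.put_arr, State.write_reg, State.write_arr] using hQ.ord
  · constructor <;>
      simp [State.put_reg, State.put_arr, State.write_reg, State.write_arr, hp, Nat.add_comm]

/-- A bound on the time of the search after the vertices in `done` have been processed. -/
def searchTime (deg : ℕ → ℕ) (done : List (Fin n)) : ℕ :=
  ∑ x with x ∉ done, ((scanBody.cost + 1) * deg x + (popBody.cost + 2)) + 1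

lemma searchTime_append (deg : ℕ → ℕ) {done : List (Fin n)} {v : Fin n} (hv : v ∉ done) :
    searchTime deg done = searchTime deg (done ++ [v]) +
      ((scanBody.cost + 1) * deg v + (popBody.cost + 2)) := by
  have h : Finset.univ.filter (fun x => x ∉ done) =
      insert v (Finset.univ.filter (fun x => x ∉ done ++ [v])) := by
    ext x
    by_cases hx : x = v <;> simp [hx, hv]
  rw [searchTime, h, Finset.sum_insert (by simp), searchTime]
  omega

lemma exec_search (hG : G.IsMedian) (hw : n * K + n + K + 3 ≤ 2 ^ w) (hnK : n ≤ K)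
    {ix : Fin n → Fin n → ℕ} (hixm : ∀ x y : Fin n, ix x y = mat (x * K + y))
    (hix : ∀ x y x' y', G.Desc b x y → G.Desc b x' y' → ix x y = ix x' y' → x = x' ∧ y = y')
    (hdeg : ∀ v : Fin n, deg v ≤ K)
    (hsound : ∀ (v : Fin n), ∀ j < deg v, ∃ u : Fin n, nbr (v * K + j) = u ∧ G.Adj v u)
    (hcomplete : ∀ v u, G.Adj v u → ∃ j < deg v, nbr (v * K + j) = u)
    {s : State} {k : ℕ} (hT : Tables n K deg nbr mat s) (hQ : Queue [] [b] s)
    (I : SearchInv G b ix [] [b] (fun _ _ => False) (s.arr 8) (s.arr 10) (s.arr 11) (s.arr 12)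
      (s.arr 2) (s.reg 2)) (hk : searchTime deg ([] : List (Fin n)) ≤ k) :
    Exec w search s k (fun s' _ => ∃ done S, (∀ x, x ∈ done) ∧
      (∀ d x, S d x ↔ d ∈ done ∧ G.Adj d x) ∧ SearchInv G b ix done [] S (s'.arr 8) (s'.arr 10)
        (s'.arr 11) (s'.arr 12) (s'.arr 2) (s'.reg 2)) := by
  refine Exec.loop (I := fun s k => ∃ done queue S, Tables n K deg nbr mat s ∧
    Queue done queue s ∧ (∀ d x, S d x ↔ d ∈ done ∧ G.Adj d x) ∧
    (∀ x ∈ queue, ∀ y ∈ queue, G.dist b y ≤ G.dist b x + 1) ∧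
    SearchInv G b ix done queue S (s.arr 8) (s.arr 10) (s.arr 11) (s.arr 12) (s.arr 2)
      (s.reg 2) ∧ searchTime deg done ≤ k)
    ⟨[], [b], _, hT, hQ, by simp, by simp, I, hk⟩ ?_ ?_ ?_
  · rintro s k ⟨done, queue, S, -, -, -, -, -, hk⟩
    rw [searchTime] at hk
    omega
  · rintro s k ⟨done, queue, S, hT, hQ, hS, hnear, I, hk⟩ hb
    simp only [Test.Holds, hQ.pos, hQ.tail] at hb
    obtain ⟨v, rest, rfl⟩ : ∃ v rest, queue = v :: rest :=
      List.exists_cons_of_length_pos (by omega)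
    have hvd : v ∉ done := fun h => (List.nodup_append.1 I.nodup).2.2 v h v (by simp) rfl
    rw [searchTime_append deg hvd] at hk
    apply Exec.seq
    refine Exec.of_pre (by omega) (popBody_pre hG hw (hdeg v) hT hQ I hS hnear) ?_
    · rintro s k' ⟨p, hT, hQ, hR, I⟩ hk'
      have hk : searchTime deg (done ++ [v]) + (scanBody.cost + 1) * deg v + 1 ≤ k' := by omega
      clear hk'
      refine Exec.loop (I := fun s k => ∃ queue S j, Tables n K deg nbr mat s ∧
        Queue (done ++ [v]) queue s ∧ ScanRegs K deg v p j s ∧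
        (∀ d x, S d x ↔ d ∈ done ++ [v] ∧ G.Adj d x ∧
          (d = v → ∃ i < j, nbr (v * K + i) = x)) ∧
        ScanInv G b ix (done ++ [v]) queue v S (s.arr 8) (s.arr 10) (s.arr 11) (s.arr 12)
          (s.arr 2) (s.reg 2) ∧
        searchTime deg (done ++ [v]) + (scanBody.cost + 1) * (deg v - j) + 1 ≤ k)
        ⟨rest, S, 0, hT, hQ, hR, ?_, I, by simpa using hk⟩ ?_ ?_ ?_
      · intro d x
        rw [hS]
        by_cases hdv : d = v
        · simp [hdv, hvd]
        · simp [hdv]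
      · rintro s k ⟨_, _, _, -, -, -, -, -, hk⟩
        omega
      · rintro s k ⟨queue, S, j, hT, hQ, hR, hS, I, hk⟩ hb
        simp only [Test.Holds, hR.cur, hR.last] at hb
        have hj : j < deg v := by omega
        obtain ⟨u, hu, huv⟩ := hsound v j hj
        have hcost : (scanBody.cost + 1) * (deg v - j) =
            (scanBody.cost + 1) * (deg v - (j + 1)) + (scanBody.cost + 1) := by
          rw [← Nat.mul_succ]
          congr 1
          omega
        refine Exec.of_pre (by omega)
          (scanBody_pre hG hw hnK hixm hix hj (hdeg v) huv hu hT hQ hR I) ?_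
        rintro s' k' ⟨queue', hT', hQ', hR', I'⟩ hk'
        refine ⟨queue', _, j + 1, hT', hQ', hR', ?_, I', by omega⟩
        intro d x
        rw [hS]
        constructor
        · rintro (⟨h1, h2, h3⟩ | ⟨rfl, rfl⟩)
          · refine ⟨h1, h2, fun h => ?_⟩
            obtain ⟨i, hi, hi'⟩ := h3 h
            exact ⟨i, by omega, hi'⟩
          · exact ⟨I.mem, huv, fun _ => ⟨j, by omega, hu⟩⟩
        · rintro ⟨h1, h2, h3⟩
          by_cases hdv : d = v
          · obtain ⟨i, hi, hi'⟩ := h3 hdv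
            by_cases hij : i = j
            · subst hij
              exact Or.inr ⟨hdv, Fin.ext (hi'.symm.trans hu)⟩
            · exact Or.inl ⟨h1, h2, fun _ => ⟨i, by omega, hi'⟩⟩
          · exact Or.inl ⟨h1, h2, fun h => absurd h hdv⟩
      · rintro s k ⟨queue, S, j, hT, hQ, hR, hS', I, hk⟩ hb
        simp only [Test.Holds, hR.cur, hR.last] at hb
        have hj : j = deg v := by
          have := hR.le
          omega
        subst hj
        refine ⟨done ++ [v], queue, S, hT, hQ, ?_, I.near_queue, I.toSearchInv, by omega⟩
        intro d x
        rw [hS']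
        refine ⟨fun h => ⟨h.1, h.2.1⟩, fun h => ⟨h.1, h.2, ?_⟩⟩
        rintro rfl
        exact hcomplete d x h.2
  · rintro s k ⟨done, queue, S, hT, hQ, hS, hnear, I, hk⟩ hb
    simp only [Test.Holds, hQ.pos, hQ.tail] at hb
    obtain rfl : queue = [] := List.eq_nil_of_length_eq_zero (by omega)
    exact ⟨done, S, I.mem_done hG hS, hS, I⟩

end WordRAM

/-! ### Reading the edge list -/

namespace WordRAM

open SimpleGraph

variable {n K w : ℕ}

lemma addr_injective {v v' j j' : ℕ} (hj : j < K) (hj' : j' < K)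
    (h : v * K + j = v' * K + j') : v = v' ∧ j = j' := by
  rcases lt_trichotomy v v' with hv | rfl | hv
  · have h1 : (v + 1) * K ≤ v' * K := Nat.mul_le_mul_right K hv
    rw [Nat.add_mul] at h1
    omega
  · exact ⟨rfl, by omega⟩
  · have h1 : (v' + 1) * K ≤ v * K := Nat.mul_le_mul_right K hv
    rw [Nat.add_mul] at h1
    omega

/-- The tables `deg`, `nbr`, `mat` represent `c` arcs: `E v u i` says that the arc with number `i`
leads from `v` to `u`. -/
structure Arcs (K : ℕ) (E : Fin n → Fin n → ℕ → Prop) (c : ℕ) (deg nbr mat : ℕ → ℕ) : Prop where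
  sum_deg : ∑ v : Fin n, deg v = c
  sound : ∀ v : Fin n, ∀ j < deg v, ∃ (u : Fin n) (i : ℕ), nbr (v * K + j) = u ∧ E v u i
  complete : ∀ (v u : Fin n) (i : ℕ), E v u i →
    (∃ j < deg v, nbr (v * K + j) = u) ∧ mat (v * K + u) = i

namespace Arcs

variable {E : Fin n → Fin n → ℕ → Prop} {c : ℕ} {deg nbr mat : ℕ → ℕ}

lemma deg_le (h : Arcs K E c deg nbr mat) (v : Fin n) : deg v ≤ c := by
  rw [← h.sum_deg]
  exact Finset.single_le_sum (f := fun v : Fin n => deg v) (fun _ _ => Nat.zero_le _)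
    (Finset.mem_univ v)

lemma add (h : Arcs K E c deg nbr mat) (hc : c < K) (hn : n ≤ K) {a b : Fin n} (i : ℕ)
    (hE : ∀ i, ¬ E a b i) :
    Arcs K (fun x y k => E x y k ∨ x = a ∧ y = b ∧ k = i) (c + 1)
      (Function.update deg a (deg a + 1)) (Function.update nbr (a * K + deg a) b)
      (Function.update mat (a * K + b) i) where
  sum_deg := by
    have h1 : ∀ v : Fin n, Function.update deg a (deg a + 1) v = deg v + if v = a then 1 else 0 := by
      intro v
      by_cases hv : v = a
      · simp [hv]
      · rw [update_val_ne _ _ hv, if_neg hv, Nat.add_zero]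
    simp [h1, Finset.sum_add_distrib, h.sum_deg]
  sound := by
    intro v j hj
    have ha := h.deg_le a
    have hv := h.deg_le v
    by_cases hja : v = a ∧ j = deg a
    · obtain ⟨rfl, rfl⟩ := hja
      exact ⟨b, i, by simp, Or.inr ⟨rfl, rfl, rfl⟩⟩
    · have hj' : j < deg v := by
        by_cases hva : v = a
        · subst hva
          rw [Function.update_self] at hj
          have : j ≠ deg v := fun h => hja ⟨rfl, h⟩
          omega
        · rwa [update_val_ne _ _ hva] at hj
      obtain ⟨u, k, h1, h2⟩ := h.sound v j hj'
      refine ⟨u, k, ?_, Or.inl h2⟩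
      rw [Function.update_of_ne, h1]
      intro he
      obtain ⟨e1, e2⟩ := addr_injective (by omega) (by omega) he
      exact hja ⟨Fin.ext e1, e2⟩
  complete := by
    have ha := h.deg_le a
    rintro v u k (hk | ⟨rfl, rfl, rfl⟩)
    · obtain ⟨⟨j, h1, h2⟩, h3⟩ := h.complete v u k hk
      have hv := h.deg_le v
      refine ⟨⟨j, ?_, ?_⟩, ?_⟩
      · by_cases hva : v = a
        · subst hva
          rw [Function.update_self]
          omega
        · rwa [update_val_ne _ _ hva]
      · rw [Function.update_of_ne, h2]
        intro he
        obtain ⟨e1, e2⟩ := addr_injective (by omega) (by omega) he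
        rw [Fin.ext e1] at h1
        omega
      · rw [Function.update_of_ne, h3]
        intro he
        obtain ⟨e1, e2⟩ := addr_injective (by omega) (by omega) he
        rw [Fin.ext e1, Fin.ext e2] at hk
        exact hE k hk
    · exact ⟨⟨deg v, by simp, by simp⟩, by simp⟩

lemma congr {E' : Fin n → Fin n → ℕ → Prop} (h : Arcs K E c deg nbr mat)
    (hE : ∀ x y k, E x y k ↔ E' x y k) : Arcs K E' c deg nbr mat := by
  have : E = E' := by
    funext x y k
    exact propext (hE x y k)
  exact this ▸ h

end Arcs

/-- The `k`-th edge of `L` joins `x` and `y`, and `k < i`. -/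
def Joins (L : List (Fin n × Fin n)) (i : ℕ) (x y : Fin n) (k : ℕ) : Prop :=
  k < i ∧ (L[k]? = some (x, y) ∨ L[k]? = some (y, x))

variable {G : SimpleGraph (Fin n)} {L : List (Fin n × Fin n)}

lemma joins_adj (hL : G.IsEdgeList L) {i k : ℕ} {x y : Fin n} (h : Joins L i x y k) :
    G.Adj x y := by
  rcases h.2 with h1 | h1
  · exact (hL.2 s(x, y)).1 (List.mem_map_of_mem (f := fun p : Fin n × Fin n => s(p.1, p.2))
      (List.mem_of_getElem? h1))
  · exact ((hL.2 s(y, x)).1 (List.mem_map_of_mem (f := fun p : Fin n × Fin n => s(p.1, p.2))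
      (List.mem_of_getElem? h1)) : G.Adj y x).symm

lemma exists_joins (hL : G.IsEdgeList L) {x y : Fin n} (h : G.Adj x y) :
    ∃ k, Joins L L.length x y k := by
  obtain ⟨⟨a, b⟩, hp, he⟩ := List.mem_map.1 ((hL.2 s(x, y)).2 h)
  obtain ⟨k, hk⟩ := List.mem_iff_getElem?.1 hp
  refine ⟨k, (List.getElem?_eq_some_iff.1 hk).1, ?_⟩
  rcases Sym2.eq_iff.1 he with ⟨h1, h2⟩ | ⟨h1, h2⟩
  · exact Or.inl (by rw [hk]; exact congrArg some (Prod.ext h1 h2))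
  · exact Or.inr (by rw [hk]; exact congrArg some (Prod.ext h1 h2))

lemma joins_index (hL : G.IsEdgeList L) {i i' k k' : ℕ} {x y : Fin n} (h : Joins L i x y k)
    (h' : Joins L i' x y k') : k = k' := by
  have key : ∀ {i k}, Joins L i x y k →
      (L.map (fun p : Fin n × Fin n => s(p.1, p.2)))[k]? = some s(x, y) := by
    rintro i k ⟨-, h | h⟩
    · simp [h]
    · simp [h, Sym2.eq_swap]
  have h1 := key h
  have h2 := key h'
  have h3 := (List.getElem?_eq_some_iff.1 h1).1
  exact (List.getElem?_inj h3 hL.1).1 (h1.trans h2.symm)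

lemma joins_sym2 {i i' k : ℕ} {x y x' y' : Fin n} (h : Joins L i x y k)
    (h' : Joins L i' x' y' k) : s(x, y) = s(x', y') := by
  rw [Sym2.eq_iff]
  rcases h.2 with h1 | h1 <;> rcases h'.2 with h2 | h2 <;> rw [h1] at h2 <;>
    simp only [Option.some.injEq, Prod.mk.injEq] at h2 <;> tauto

/-- The input and the constants of the program. -/
structure Base (L : List (Fin n × Fin n)) (K : ℕ) (s : State) : Prop where
  vertices : s.reg 0 = n
  edges : s.reg 1 = L.length
  row_len : s.reg 3 = K
  zero : s.reg 4 = 0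
  one : s.reg 5 = 1
  two : s.reg 6 = 2
  input : ∀ (i : ℕ) (p : Fin n × Fin n), L[i]? = some p → s.arr 0 i = p.1 ∧ s.arr 1 i = p.2

/-- The tables before the first `i` vertices have been treated. -/
structure Rows (n K i : ℕ) (s : State) : Prop where
  row : ∀ v < i, s.arr 3 v = v * K
  deg : ∀ v < i, s.arr 4 v = 0
  flag : ∀ v < i, s.arr 8 v = 0

lemma exec_initConstants (hw : n + L.length + L.length + 3 ≤ 2 ^ w) {s : State}
    (hs : IsInput L s) {k : ℕ} (hk : 8 ≤ k) :
    Exec w initConstants s k (fun s' k' => Base L (n + L.length + L.length) s' ∧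
      s'.reg 7 = 0 ∧ s'.reg 8 = 0 ∧ k ≤ k' + 8) := by
  have hcost : initConstants.cost = 8 := rfl
  refine Exec.of_pre (R := fun s' => Base L (n + L.length + L.length) s' ∧
      s'.reg 7 = 0 ∧ s'.reg 8 = 0) (hcost ▸ hk) ?_
    (fun s' k' h hk' => ⟨h.1, h.2.1, h.2.2, hcost ▸ hk'⟩)
  simp only [initConstants, block, Program.pre, State.put_reg, hs.1, hs.2.1,
    Nat.reduceEqDiff, if_true, if_false]
  refine ⟨by omega, by omega, by omega, by omega, by omega, by omega, by omega, ?_, ?_, ?_⟩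
  · constructor
    case input =>
      intro i p hp
      obtain ⟨hi, hp⟩ := List.getElem?_eq_some_iff.1 hp
      have := hs.2.2 ⟨i, hi⟩
      simpa [State.put_arr, hp] using this
    all_goals simp [State.put_reg, hs.1, hs.2.1]
  · simp
  · simp

lemma exec_initRows (hw : n * K + n + K + 3 ≤ 2 ^ w) {s : State} (hs : Base L K s)
    (h7 : s.reg 7 = 0) (h8 : s.reg 8 = 0) {k r : ℕ} (hk : 7 * n + 1 + r ≤ k) :
    Exec w initRows s k (fun s' k' => Base L K s' ∧ Rows n K n s' ∧ r ≤ k') := by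
  refine Exec.loop (I := fun s k => ∃ i ≤ n, Base L K s ∧ s.reg 7 = i ∧ s.reg 8 = i * K ∧
    Rows n K i s ∧ 7 * (n - i) + 1 + r ≤ k)
    ⟨0, Nat.zero_le _, hs, h7, by simpa using h8, ⟨by simp, by simp, by simp⟩, by omega⟩
    ?_ ?_ ?_
  · rintro s k ⟨i, -, -, -, -, -, hk⟩
    omega
  · rintro s k ⟨i, -, hB, h7, h8, hR, hk⟩ hb
    simp only [Test.Holds, h7, hB.vertices] at hb
    have a1 : i * K + K ≤ n * K := by
      have : (i + 1) * K ≤ n * K := Nat.mul_le_mul_right K hb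
      rwa [Nat.succ_mul] at this
    refine Exec.of_pre (R := fun s => Base L K s ∧ s.reg 7 = i + 1 ∧ s.reg 8 = (i + 1) * K ∧
      Rows n K (i + 1) s) (by simp only [block, Program.cost]; omega) ?_
      (fun s' k' h hk' => ⟨i + 1, hb, h.1, h.2.1, h.2.2.1, h.2.2.2, by
        simp only [block, Program.cost] at hk'; omega⟩)
    simp only [block, Program.pre, State.put_reg, State.write_reg, h7, h8, hB.zero, hB.one, hB.row_len, Nat.reduceEqDiff, if_true, if_false]
    refine ⟨by omega, by omega, ?_, trivial, (Nat.succ_mul i K).symm, ?_⟩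
    · constructor
      case input =>
        simpa [State.put_arr, State.write_arr] using hB.input
      all_goals simp [State.put_reg, State.write_reg, hB.vertices, hB.edges, hB.zero, hB.one,
        hB.two, hB.row_len]
    · have hne : ∀ v < i + 1, v ≠ i → v < i := fun v h1 h2 => by omega
      constructor <;> intro v hv <;> by_cases hvi : v = i
      · simp [State.put_arr, State.write_arr, hvi]
      · simp [State.put_arr, State.write_arr, hvi, hR.row v (hne v hv hvi)]
      · simp [State.put_arr, State.write_arr, hvi]
      · simp [State.put_arr, State.write_arr, hvi, hR.deg v (hne v hv hvi)]
      · simp [State.put_arr, State.write_arr, hvi]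
      · simp [State.put_arr, State.write_arr, hvi, hR.flag v (hne v hv hvi)]
  · rintro s k ⟨i, hi, hB, h7, h8, hR, hk⟩ hb
    simp only [Test.Holds, h7, hB.vertices] at hb
    obtain rfl : i = n := by omega
    exact ⟨hB, hR, by omega⟩

/-- The tables after `i` edges have been read. -/
structure Reading (L : List (Fin n × Fin n)) (K i : ℕ) (s : State) : Prop where
  base : Base L K s
  row : ∀ v : Fin n, s.arr 3 v = v * K
  flag : ∀ v : Fin n, s.arr 8 v = 0
  arcs : Arcs K (Joins L i) (2 * i) (s.arr 4) (s.arr 5) (s.arr 6)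

lemma Arcs.add_edge (hL : G.IsEdgeList L) {i : ℕ} {deg nbr mat : ℕ → ℕ} {a b : Fin n}
    (hi : L[i]? = some (a, b)) (hK : n + L.length + L.length = K)
    (h : Arcs K (Joins L i) (2 * i) deg nbr mat) :
    Arcs K (Joins L (i + 1)) (2 * (i + 1))
      (Function.update (Function.update deg a (deg a + 1)) b (deg b + 1))
      (Function.update (Function.update nbr (a * K + deg a) b) (b * K + deg b) a)
      (Function.update (Function.update mat (a * K + b) i) (b * K + a) i) := by
  have hlen := (List.getElem?_eq_some_iff.1 hi).1
  have hab : Joins L (i + 1) a b i := ⟨by omega, Or.inl hi⟩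
  have hba : Joins L (i + 1) b a i := ⟨by omega, Or.inr hi⟩
  have hne : b ≠ a := (joins_adj hL hab).ne'
  have h1 := h.add (a := a) (b := b) (by omega) (by omega) i (fun k hk => by
    have := joins_index hL hab hk
    have := hk.1
    omega)
  have h2 := h1.add (a := b) (b := a) (by omega) (by omega) i (by
    rintro k (hk | ⟨h, -⟩)
    · have := joins_index hL hba hk
      have := hk.1
      omega
    · exact hne h)
  rw [update_val_ne _ _ hne] at h2
  refine h2.congr (fun x y k => ?_)
  constructor
  · rintro ((hk | ⟨rfl, rfl, rfl⟩) | ⟨rfl, rfl, rfl⟩)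
    · exact ⟨by have := hk.1; omega, hk.2⟩
    · exact hab
    · exact hba
  · rintro ⟨hk, hk'⟩
    by_cases hki : k = i
    · subst hki
      rw [hi] at hk'
      simp only [Option.some.injEq, Prod.mk.injEq] at hk'
      tauto
    · exact Or.inl (Or.inl ⟨by omega, hk'⟩)

lemma exec_readEdges (hL : G.IsEdgeList L) (hK : n + L.length + L.length = K)
    (hw : n * K + n + K + 3 ≤ 2 ^ w) {s : State} (h7 : s.reg 7 = 0) (hR : Reading L K 0 s)
    {k r : ℕ} (hk : 21 * L.length + 1 + r ≤ k) :
    Exec w readEdges s k (fun s' k' => Reading L K L.length s' ∧ r ≤ k') := by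
  refine Exec.loop (I := fun s k => ∃ i ≤ L.length, s.reg 7 = i ∧ Reading L K i s ∧
    21 * (L.length - i) + 1 + r ≤ k) ⟨0, Nat.zero_le _, h7, hR, by omega⟩ ?_ ?_ ?_
  · rintro s k ⟨i, -, -, -, hk⟩
    omega
  · rintro s k ⟨i, -, h7, hR, hk⟩ hb
    have hB := hR.base
    simp only [Test.Holds, h7, hB.edges] at hb
    obtain ⟨⟨a, b⟩, hi⟩ : ∃ p, L[i]? = some p := ⟨L[i], List.getElem?_eq_getElem hb⟩
    obtain ⟨hia, hib⟩ := hB.input i _ hi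
    have hne : b ≠ a := (joins_adj hL (⟨hb, Or.inl hi⟩ : Joins L L.length a b i)).ne'
    have da := hR.arcs.deg_le a
    have db := hR.arcs.deg_le b
    have a1 := addr_lt a (j := b) (K := K) (by omega)
    have a2 := addr_lt b (j := a) (K := K) (by omega)
    have a3 := addr_lt a (j := s.arr 4 a) (K := K) (by omega)
    have a4 := addr_lt b (j := s.arr 4 b) (K := K) (by omega)
    refine Exec.of_pre (R := fun s => s.reg 7 = i + 1 ∧ Reading L K (i + 1) s)
      (by simp only [block, Program.cost]; omega) ?_
      (fun s' k' h hk' => ⟨i + 1, hb, h.1, h.2, by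
        simp only [block, Program.cost] at hk'; omega⟩)
    have hup := update_val_ne (s.arr 4) (s.arr 4 a + 1) hne
    have harcs := hR.arcs.add_edge hL hi hK
    simp only [block, Program.pre, State.put_reg, State.put_arr, State.write_reg,
      State.write_arr, h7, hia, hib, hR.row, hB.one, hup, Nat.reduceEqDiff, if_true, if_false]
    refine ⟨by omega, by omega, by omega, by omega, by omega, by omega, by omega, trivial, ?_⟩
    constructor
    · constructor
      case input => simpa [State.put_arr, State.write_arr] using hB.input
      all_goals simp [State.put_reg, State.write_reg, hB.vertices, hB.edges, hB.zero, hB.one,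
        hB.two, hB.row_len]
    · simpa [State.put_arr, State.write_arr] using hR.row
    · simpa [State.put_arr, State.write_arr] using hR.flag
    · simpa only [State.put_arr, State.write_arr, Nat.reduceEqDiff, if_true, if_false] using harcs
  · rintro s k ⟨i, hi, h7, hR, hk⟩ hb
    simp only [Test.Holds, h7, hR.base.edges] at hb
    obtain rfl : i = L.length := by omega
    exact ⟨hR, by omega⟩

lemma exec_initSearch (hw : n * K + n + K + 3 ≤ 2 ^ w) {s : State} {b : Fin n} (hb : (b : ℕ) = 0)
    {i : ℕ} (ix : Fin n → Fin n → ℕ) (hR : Reading L K i s) {k : ℕ} (hk : 9 ≤ k) :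
    Exec w initSearch s k (fun s' k' => Tables n K (s.arr 4) (s.arr 5) (s.arr 6) s' ∧
      Queue [] [b] s' ∧ SearchInv G b ix [] [b] (fun _ _ => False) (s'.arr 8) (s'.arr 10)
        (s'.arr 11) (s'.arr 12) (s'.arr 2) (s'.reg 2) ∧ k ≤ k' + 9) := by
  have hB := hR.base
  have hcost : initSearch.cost = 9 := rfl
  refine Exec.of_pre (R := fun s' => Tables n K (s.arr 4) (s.arr 5) (s.arr 6) s' ∧
      Queue [] [b] s' ∧ SearchInv G b ix [] [b] (fun _ _ => False) (s'.arr 8) (s'.arr 10)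
        (s'.arr 11) (s'.arr 12) (s'.arr 2) (s'.reg 2)) (hcost ▸ hk) ?_
    (fun s' k' h hk' => ⟨h.1, h.2.1, h.2.2, hcost ▸ hk'⟩)
  simp only [initSearch, block, Program.pre, State.put_reg, State.put_arr, State.write_reg,
    State.write_arr, hB.zero, hB.one, Nat.reduceEqDiff, if_true, if_false]
  refine ⟨by omega, by omega, by omega, ?_, ?_, ?_⟩
  · constructor <;> simp [State.put_reg, State.put_arr, State.write_reg, State.write_arr, hB.zero,
      hB.one, hB.two, hR.row]
  · constructor
    · simp [State.put_reg, State.write_reg]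
    · simp [State.put_reg, State.write_reg]
    · intro j x hx
      rw [List.nil_append, List.getElem?_singleton] at hx
      split_ifs at hx with hj
      obtain rfl : b = x := by simpa using hx
      have hj : j = 0 := by omega
      simp [State.put_arr, State.write_arr, hj, hb]
  · apply SearchInv.init
    · intro x hx
      have hx0 : (x : ℕ) ≠ 0 := fun h => hx (Fin.ext (h.trans hb.symm))
      rw [Function.update_of_ne hx0]
      exact hR.flag x
    · simp [hb]
    · simp [hb]
    · simp [hb]

lemma isThetaOutput (hG : G.IsMedian) (hL : G.IsEdgeList L) {b : Fin n} {deg nbr mat : ℕ → ℕ}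
    {c : ℕ} (hA : Arcs K (Joins L L.length) c deg nbr mat) {done : List (Fin n)}
    {S : Fin n → Fin n → Prop} {s : State} (hdone : ∀ x, x ∈ done)
    (hS : ∀ d x, S d x ↔ d ∈ done ∧ G.Adj d x)
    (I : SearchInv G b (fun x y => mat (x * K + y)) done [] S (s.arr 8) (s.arr 10) (s.arr 11)
      (s.arr 12) (s.arr 2) (s.reg 2)) : IsThetaOutput G L s := by
  have hlab : ∀ x y i, G.Desc b x y → Joins L L.length x y i →
      s.arr 2 i = s.arr 12 (G.rootOf b x y) := by
    intro x y i hd hi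
    rw [← (hA.complete x y i hi).2]
    exact I.lab_eq x y ((hS x y).2 ⟨hdone x, hd.1⟩) hd
  have key : ∀ i : Fin L.length, ∃ x y, G.Desc b x y ∧
      s((L.get i).1, (L.get i).2) = s(x, y) ∧ s.arr 2 i = s.arr 12 (G.rootOf b x y) := by
    intro i
    have hi : L[(i : ℕ)]? = some ((L.get i).1, (L.get i).2) := by simp
    have hj : Joins L L.length (L.get i).1 (L.get i).2 i := ⟨i.2, Or.inl hi⟩
    rcases hG.desc_or_desc (b := b) (joins_adj hL hj) with h | h
    · exact ⟨_, _, h, rfl, hlab _ _ _ h hj⟩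
    · exact ⟨_, _, h, Sym2.eq_swap, hlab _ _ _ h ⟨i.2, Or.inr hi⟩⟩
  refine ⟨fun i => ?_, fun k hk => ?_, fun i j => ?_⟩
  · obtain ⟨x, y, hd, -, h⟩ := key i
    obtain ⟨r, hr⟩ := SearchInv.isRoot_rootOf hG hd
    rw [h]
    exact I.root_lt _ (hdone _) r hr
  · obtain ⟨r, -, d, hr, rfl⟩ := I.root_surj k hk
    obtain ⟨i, hi⟩ := exists_joins hL hr.1.1
    refine ⟨⟨i, hi.1⟩, ?_⟩
    rw [hlab r d i hr.1 hi, hG.rootOf_root hr]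
  · obtain ⟨x, y, hd, he, h⟩ := key i
    obtain ⟨x', y', hd', he', h'⟩ := key j
    rw [he, he', hG.theta_iff hd hd', h, h']
    obtain ⟨r, hr⟩ := SearchInv.isRoot_rootOf hG hd
    obtain ⟨r', hr'⟩ := SearchInv.isRoot_rootOf hG hd'
    exact ⟨I.root_inj _ (hdone _) _ (hdone _) r r' hr hr', fun h => by rw [h]⟩

lemma length_eq_card_edgeFinset (hL : G.IsEdgeList L) : L.length = Nat.card G.edgeSet := by
  classical
  have h : (G.edgeSet : Set (Sym2 (Fin n))) =
      ((L.map (fun p : Fin n × Fin n => s(p.1, p.2))).toFinset : Set (Sym2 (Fin n))) := by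
    ext e
    rw [List.coe_toFinset]
    exact (hL.2 e).symm
  rw [h, Nat.card_coe_set_eq, Set.ncard_coe_finset, List.toFinset_card_of_nodup hL.1,
    List.length_map]

lemma searchTime_nil {E : Fin n → Fin n → ℕ → Prop} {c : ℕ} {deg nbr mat : ℕ → ℕ}
    (hA : Arcs K E c deg nbr mat) : searchTime deg ([] : List (Fin n)) =
      (scanBody.cost + 1) * c + n * (popBody.cost + 2) + 1 := by
  simp [searchTime, Finset.sum_add_distrib, ← Finset.mul_sum, hA.sum_deg]

lemma exec_thetaProgram (hG : G.IsMedian) (hL : G.IsEdgeList L)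
    (hK : n + L.length + L.length = K) (hw : n * K + n + K + 3 ≤ 2 ^ w) {s : State}
    (hs : IsInput L s) {k : ℕ} (hk : 200 * (L.length + 1) ≤ k) :
    Exec w thetaProgram s k (fun s' _ => IsThetaOutput G L s') := by
  have hn : n ≤ L.length + 1 := by
    have := hG.1.card_vert_le_card_edgeSet_add_one
    rwa [← length_eq_card_edgeFinset hL, Nat.card_fin] at this
  have hn0 : 0 < n := by
    obtain ⟨v⟩ := hG.1.nonempty
    exact v.pos
  have hscan : scanBody.cost = 35 := rfl
  have hpop : popBody.cost = 18 := rfl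
  apply Exec.seq
  refine (exec_initConstants (by omega) hs (k := k) (by omega)).mono ?_
  rintro s k₁ ⟨hB, h7, h8, hk₁⟩
  rw [hK] at hB
  apply Exec.seq
  refine (exec_initRows hw hB h7 h8 (r := k₁ - 7 * n - 1) (by omega)).mono ?_
  rintro s k₂ ⟨hB, hR, hk₂⟩
  apply Exec.seq
  refine Exec.of_pre (R := fun s' => s'.reg 7 = 0 ∧ Reading L K 0 s')
    (by simp only [Program.cost]; omega) ?_ ?_
  · refine ⟨by omega, by simp [State.put_reg], ?_⟩
    constructor
    · constructor
      case input => exact hB.input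
      all_goals simp [State.put_reg, hB.vertices, hB.edges, hB.zero, hB.one, hB.two, hB.row_len]
    · exact fun v => hR.row v v.2
    · exact fun v => hR.flag v v.2
    · rw [State.put_arr]
      have hdeg : ∀ v : Fin n, s.arr 4 v = 0 := fun v => hR.deg v v.2
      refine ⟨by simp [hdeg], fun v j hj => ?_, fun v u i hi => ?_⟩
      · rw [hdeg] at hj
        omega
      · exact absurd hi.1 (Nat.not_lt_zero _)
  rintro s k₃ ⟨h7, hR⟩ hk₃
  simp only [Program.cost] at hk₃
  apply Exec.seq
  refine (exec_readEdges hL hK hw h7 hR (r := k₃ - 21 * L.length - 1) (by omega)).mono ?_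
  rintro s k₄ ⟨hR, hk₄⟩
  apply Exec.seq
  refine (exec_initSearch (G := G) hw (b := ⟨0, hn0⟩) rfl (fun x y => s.arr 6 (x * K + y)) hR
    (by omega)).mono ?_
  rintro s' k₅ ⟨hT, hQ, I, hk₅⟩
  have hA := hR.arcs
  refine (exec_search hG hw (by omega) (fun _ _ => rfl) ?_ (fun v => ?_) ?_ ?_ hT hQ I ?_).mono ?_
  · intro x y x' y' hd hd' he
    obtain ⟨i, hi⟩ := exists_joins hL hd.1
    obtain ⟨i', hi'⟩ := exists_joins hL hd'.1
    rw [(hA.complete x y i hi).2, (hA.complete x' y' i' hi').2] at he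
    subst he
    rcases Sym2.eq_iff.1 (joins_sym2 hi hi') with h | ⟨rfl, rfl⟩
    · exact h
    · have := hd.2
      have := hd'.2
      omega
  · have := hA.deg_le v
    omega
  · intro v j hj
    obtain ⟨u, i, h1, h2⟩ := hA.sound v j hj
    exact ⟨u, h1, joins_adj hL h2⟩
  · intro v u h
    obtain ⟨i, hi⟩ := exists_joins hL h
    exact (hA.complete v u i hi).1
  · rw [searchTime_nil hA, hscan, hpop]
    omega
  · rintro s'' - ⟨done, S, hdone, hS, I⟩
    exact isThetaOutput hG hL hA hdone hS I

end WordRAM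

/-- There is one word-RAM program that computes the `Θ`-classes of every median graph with `m`
edges in time `O(m)`, on words of `O(log n)` bits. (The time bound reads `C * (m + 1)` because the
one-vertex graph has `m = 0`.) -/
theorem theorem4p2 :
    ∃ (P : WordRAM.Program) (C c : ℕ),
      ∀ (n : ℕ) (G : SimpleGraph (Fin n)) (L : List (Fin n × Fin n)),
        G.IsMedian → G.IsEdgeList L →
        ∀ w : ℕ, (n + L.length + 1) ^ c ≤ 2 ^ w →
        ∀ s : WordRAM.State, s.Fits w → WordRAM.IsInput L s →
          ∃ (s' : WordRAM.State) (t : ℕ),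
            WordRAM.Runs w P s s' t ∧ t ≤ C * (L.length + 1) ∧
              WordRAM.IsThetaOutput G L s' := by
  refine ⟨WordRAM.thetaProgram, 200, 4, fun n G L hG hL w hw s hs hin => ?_⟩
  have hn0 : 0 < n := by
    obtain ⟨v⟩ := hG.1.nonempty
    exact v.pos
  have hroom : n * (n + L.length + L.length) + n + (n + L.length + L.length) + 3 ≤ 2 ^ w := by
    refine le_trans ?_ hw
    obtain ⟨a, rfl⟩ : ∃ a, n = a + 1 := ⟨n - 1, by omega⟩
    generalize L.length = m
    have h : (a + 1 + m + 1) ^ 4 = (a + m) ^ 4 + 8 * (a + m) ^ 3 + 24 * (a + m) ^ 2 +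
      32 * (a + m) + 16 := by ring
    rw [h]
    nlinarith [Nat.zero_le ((a + m) ^ 4), Nat.zero_le ((a + m) ^ 3), Nat.zero_le (a * m),
      Nat.zero_le (m * m), Nat.zero_le (a * a)]
  obtain ⟨s', t, h1, h2, -, h3⟩ := WordRAM.exec_thetaProgram hG hL rfl hroom hin le_rfl hs
  exact ⟨s', t, h1, h2, h3⟩
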